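/- Let $A\in\mathbb C^{n\times n}$ have all its eigenvalues in the open unit disc, let $B\in\mathbb C^{n\times m}$ have full column rank, let $(A,B)$ be reachable, i.e. $\operatorname{rank}[B,AB,\dots,A^{n-1}B]=n$, and put $G(z)=(zI-A)^{-1}B$. On the unit circle $\mathbb T$ let $G^*$ denote the pointwise conjugate transpose of $G$; all integrals are over $\mathbb T$ with respect to the normalized Lebesgue measure $d\vartheta/2\pi$. Let $\Psi$ be a bounded and coercive $\mathbb C^{m\times m}$-valued spectral density on $\mathbb T$, i.e. a measurable Hermitian-valued function with $aI\le\Psi\le bI$ almost everywhere for some constants $0<a\le b$. For continuous functions $\Phi$ from $\mathbb T$ to the Hermitian $m\times m$ matrices let $\Gamma(\Phi)=\int G\Phi G^*$, and put $$P_\Gamma=\{\Sigma\in\operatorname{Range}\Gamma : \Sigma>0\},\qquad \mathcal L^H_\Gamma=\{\Lambda\in\operatorname{Range}\Gamma : I+G^*(z)\Lambda G(z)>0\ \text{ for all } z\in\mathbb T\}.$$ Then for every $\Sigma\in P_\Gamma$ the functional $$J(\Lambda;\Sigma)=\operatorname{tr}\int (I+G^*\Lambda G)^{-1}\Psi+\operatorname{tr}\Lambda\Sigma$$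 has a unique minimum point $\Lambda^H_{\mathrm{opt}}(\Sigma)$ over $\mathcal L^H_\Gamma$, and the map $\Sigma\mapsto\Lambda^H_{\mathrm{opt}}(\Sigma)$ is continuous from $P_\Gamma$ to $\mathcal L^H_\Gamma$ (both with the topology of the space of $n\times n$ matrices). -/

import Mathlib

open MeasureTheory

open scoped Matrix ComplexOrder

noncomputable section

namespace SpectrumApprox

/-- `A` is a (discrete-time) stability matrix: all its eigenvalues lie in the open unit disc. -/
def IsStabilityMatrix {n : ℕ} (A : Matrix (Fin n) (Fin n) ℂ) : Prop :=
  ∀ μ ∈ spectrum ℂ A, ‖μ‖ < 1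

/-- The reachability matrix `[B, A B, …, A ^ (n - 1) B]`; its columns are indexed by the pairs
`(k, j)` of a block `k` and a column `j` of the block `A ^ k B`. -/
def reachabilityMatrix {n m : ℕ} (A : Matrix (Fin n) (Fin n) ℂ) (B : Matrix (Fin n) (Fin m) ℂ) :
    Matrix (Fin n) (Fin n × Fin m) ℂ :=
  Matrix.of fun i p => (A ^ (p.1 : ℕ) * B) i p.2

/-- `(A, B)` is a reachable pair. -/
def IsReachable {n m : ℕ} (A : Matrix (Fin n) (Fin n) ℂ) (B : Matrix (Fin n) (Fin m) ℂ) : Prop :=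
  (reachabilityMatrix A B).rank = n

/-- The transfer function `G(z) = (z I - A)⁻¹ B`, on the unit circle. -/
def transferFun {n m : ℕ} (A : Matrix (Fin n) (Fin n) ℂ) (B : Matrix (Fin n) (Fin m) ℂ)
    (z : Circle) : Matrix (Fin n) (Fin m) ℂ :=
  ((z : ℂ) • (1 : Matrix (Fin n) (Fin n) ℂ) - A)⁻¹ * B

/-- The (entrywise) integral of a matrix-valued function over the unit circle with respect to the
normalized Lebesgue measure `dθ / 2π`. -/
def circleMean {k l : ℕ} (F : Circle → Matrix (Fin k) (Fin l) ℂ) : Matrix (Fin k) (Fin l) ℂ :=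
  Matrix.of fun i j => ((2 * Real.pi : ℝ) : ℂ)⁻¹ *
    ∫ θ in (0 : ℝ)..(2 * Real.pi), F (Circle.exp θ) i j

/-- The operator `Γ(Φ) = ∫ G Φ G*` on the continuous functions from the unit circle to the
Hermitian `m × m` matrices. -/
def gammaOp {n m : ℕ} (A : Matrix (Fin n) (Fin n) ℂ) (B : Matrix (Fin n) (Fin m) ℂ)
    (Φ : C(Circle, selfAdjoint (Matrix (Fin m) (Fin m) ℂ))) : Matrix (Fin n) (Fin n) ℂ :=
  circleMean fun z =>
    transferFun A B z * (Φ z : Matrix (Fin m) (Fin m) ℂ) * (transferFun A B z)ᴴ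

/-- `P_Γ`: the positive definite matrices in the range of `Γ`. -/
def PGamma {n m : ℕ} (A : Matrix (Fin n) (Fin n) ℂ) (B : Matrix (Fin n) (Fin m) ℂ) :
    Set (Matrix (Fin n) (Fin n) ℂ) :=
  {S | S ∈ Set.range (gammaOp A B) ∧ S.PosDef}

/-- `Q_Λ(z) = I + G*(z) Λ G(z)`. -/
def QFun {n m : ℕ} (A : Matrix (Fin n) (Fin n) ℂ) (B : Matrix (Fin n) (Fin m) ℂ)
    (L : Matrix (Fin n) (Fin n) ℂ) (z : Circle) : Matrix (Fin m) (Fin m) ℂ :=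
  1 + (transferFun A B z)ᴴ * L * transferFun A B z

/-- `𝓛^H`: the Hermitian `n × n` matrices `Λ` such that `I + G* Λ G > 0` on the whole circle. -/
def LH {n m : ℕ} (A : Matrix (Fin n) (Fin n) ℂ) (B : Matrix (Fin n) (Fin m) ℂ) :
    Set (Matrix (Fin n) (Fin n) ℂ) :=
  {L | L.IsHermitian ∧ ∀ z : Circle, (QFun A B L z).PosDef}

/-- `𝓛^H_Γ = 𝓛^H ∩ Range Γ`. -/
def LHGamma {n m : ℕ} (A : Matrix (Fin n) (Fin n) ℂ) (B : Matrix (Fin n) (Fin m) ℂ) :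
    Set (Matrix (Fin n) (Fin n) ℂ) :=
  LH A B ∩ Set.range (gammaOp A B)

/-- `Ψ` is a bounded and coercive `m × m` spectral density on the unit circle: it is measurable
and `a I ≤ Ψ ≤ b I` (in particular `Ψ` is Hermitian) almost everywhere, for some constants `0 < a`
and `b`. -/
structure IsSpectralDensity {m : ℕ} (Ψ : Circle → Matrix (Fin m) (Fin m) ℂ) : Prop where
  measurable : ∀ i j, AEMeasurable (fun θ : ℝ => Ψ (Circle.exp θ) i j)
  coercive : ∃ a : ℝ, 0 < a ∧ ∀ᵐ θ : ℝ,
    (Ψ (Circle.exp θ) - (a : ℂ) • (1 : Matrix (Fin m) (Fin m) ℂ)).PosSemidef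
  bounded : ∃ b : ℝ, ∀ᵐ θ : ℝ,
    ((b : ℂ) • (1 : Matrix (Fin m) (Fin m) ℂ) - Ψ (Circle.exp θ)).PosSemidef

/-- The dual functional `J(Λ; Σ) = tr ∫ (I + G* Λ G)⁻¹ Ψ + tr Λ Σ`. When `A` is a
stability matrix, `Ψ` is a bounded spectral density, `Λ` is in `𝓛^H` and `Σ` is Hermitian, the
function `(I + G* Λ G)⁻¹` is continuous, the integrand is integrable, and both traces are real, so
that taking the real part only changes the type. -/
def dualJ {n m : ℕ} (A : Matrix (Fin n) (Fin n) ℂ) (B : Matrix (Fin n) (Fin m) ℂ)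
    (Ψ : Circle → Matrix (Fin m) (Fin m) ℂ) (L S : Matrix (Fin n) (Fin n) ℂ) : ℝ :=
  ((circleMean fun z => (QFun A B L z)⁻¹ * Ψ z).trace + (L * S).trace).re

end SpectrumApprox

end

noncomputable section

namespace SpectrumApprox

/-! ### Minimization of convex functions with parameters. -/

open Filter Topology

/-! On the finite-dimensional real space Range Γ, J is a barrier term tr ∫ (I + G*ΛG)⁻¹Ψ plus the
linear term tr ΛΣ, on an open convex domain. The argument is the standard one for such problems:
strict convexity gives uniqueness, compact sublevel sets give existence, and strict convexity with
joint continuity gives continuity of the minimizer (`continuous_argmin`).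

Strict convexity: completing the square shows that X ↦ tr X⁻¹Ψ is convex with an explicit remainder
(`trace_inv_mul_convex`). The remainder vanishes identically only if G*ΛG agrees at the two
endpoints, and Λ ↦ G*ΛG is injective on Range Γ, because Λ = Γ(Φ) gives tr Λ² = ∫ tr G*ΛGΦ.

Sublevel sets are bounded: suppose Σ = ∫ GΦG* with Φ continuous and positive definite. A recession
direction Λ, one with G*ΛG ≥ 0 and tr ΛΣ ≤ 0, then has G*ΛG = 0, hence Λ = 0. A compactness argument
turns this into a norm bound (`exists_norm_le_of_trace_le`).

Membership of Σ in P_Γ provides only a Hermitian density, so a positive one has to be built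
(`exists_posDef_density`). With N = (B*Σ⁻¹B)⁻¹, K = NB*Σ⁻¹ and M = (I − BK)A, one finds Σ = MΣM* +
BNB*, so that M is stable. Then u = z(zI − M)⁻¹B satisfies ∫ uNu* = Σ and factors as u = GR with R
invertible on the circle; the density is RNR*.

Sublevel sets stay away from the boundary: for bounded Λ, I + G*ΛG is Lipschitz along the circle. If
its least eigenvalue is q at some point, the trace of the inverse at angular distance x is at least
1/(q + Kx), whose integral blows up logarithmically as q → 0 (`exists_lower_bound_of_barrier_le`).
-/

/-- A continuous function one of whose sublevel sets is contained in a compact subset of its domain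
attains its minimum. -/
theorem exists_isMinOn_of_sublevel_subset {X : Type*} [TopologicalSpace X] {C K : Set X}
    {f : X → ℝ} {x₀ : X} (hf : ContinuousOn f C) (hK : IsCompact K) (hKC : K ⊆ C) (hx₀ : x₀ ∈ C)
    (h : ∀ x ∈ C, f x ≤ f x₀ → x ∈ K) : ∃ x ∈ C, IsMinOn f C x := by
  obtain ⟨x, hxK, hx⟩ := hK.exists_isMinOn ⟨x₀, h x₀ hx₀ le_rfl⟩ (hf.mono hKC)
  refine ⟨x, hKC hxK, fun y hy => ?_⟩
  rcases le_total (f y) (f x₀) with hyx | hyx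
  · exact hx (h y hy hyx)
  · exact (hx (h x₀ hx₀ le_rfl)).trans hyx

/-- The minimum point of a strictly convex function depends continuously on parameters. -/
theorem continuous_argmin {P E : Type*} [TopologicalSpace P] [NormedAddCommGroup E]
    [NormedSpace ℝ E] [FiniteDimensional ℝ E] {C : Set E} (hC : IsOpen C) {h : P → E → ℝ}
    (hconv : ∀ p, StrictConvexOn ℝ C (h p))
    (hcont : ContinuousOn (fun q : P × E => h q.1 q.2) (Set.univ ×ˢ C)) {opt : P → E}
    (hopt : ∀ p, opt p ∈ C) (hmin : ∀ p, IsMinOn (h p) C (opt p)) : Continuous opt := by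
  have : ProperSpace E := FiniteDimensional.proper ℝ E
  rw [continuous_iff_continuousAt]
  intro p
  obtain ⟨r₀, hr₀, hball⟩ := Metric.isOpen_iff.1 hC _ (hopt p)
  have hcat : ∀ q : P × E, q.2 ∈ C → ContinuousAt (fun q : P × E => h q.1 q.2) q := fun q hq =>
    hcont.continuousAt ((isOpen_univ.prod hC).mem_nhds ⟨trivial, hq⟩)
  rw [ContinuousAt, Metric.tendsto_nhds]
  intro ε hε
  -- The sphere of this radius lies in `C` and inside the `ε`-ball. On it `h p` strictly exceeds its
  -- minimum, and compactness carries this gap to nearby parameters.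
  set r := min (ε / 2) (r₀ / 2)
  have hr : 0 < r := by positivity
  have hrε : r < ε := (min_le_left _ _).trans_lt (by linarith)
  have hrr : r < r₀ := (min_le_right _ _).trans_lt (by linarith)
  have hsC : Metric.sphere (opt p) r ⊆ C := fun y hy =>
    hball (by rw [Metric.mem_ball, Metric.mem_sphere.1 hy]; exact hrr)
  have key : ∀ᶠ p' in 𝓝 p, ∀ y ∈ Metric.sphere (opt p) r, h p' (opt p) < h p' y := by
    refine (isCompact_sphere (opt p) r).eventually_forall_of_forall_eventually fun y hy => ?_
    have hlt : h p (opt p) < h p y := by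
      refine lt_of_le_of_ne (hmin p (hsC hy)) fun heq => ?_
      have : IsMinOn (h p) C y := fun z hz => heq ▸ hmin p hz
      have := (hconv p).eq_of_isMinOn this (hmin p) (hsC hy) (hopt p)
      rw [this, Metric.mem_sphere, dist_self] at hy
      exact hr.ne hy
    have h1 : ContinuousAt (fun q : P × E => h q.1 (opt p)) (p, y) :=
      ContinuousAt.comp (x := (p, y)) (f := fun q : P × E => (q.1, opt p))
        (g := fun q : P × E => h q.1 q.2) (hcat (p, opt p) (hopt p)) (by fun_prop)
    have h2 := hcat (p, y) (hsC hy)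
    exact h1.eventually_lt h2 hlt
  filter_upwards [key] with p' hp'
  by_contra! hd
  set d := dist (opt p') (opt p) with hd_def
  have hd0 : 0 < d := hε.trans_le hd
  set s := r / d
  have hs0 : 0 < s := by positivity
  have hs1 : s < 1 := (div_lt_one hd0).2 (by linarith)
  -- A minimizer for `p'` at distance at least `ε` would make the segment from `opt p` cross the
  -- sphere at `y`. Convexity bounds `h p' y` by `h p' (opt p)`, against the gap.
  set y := (1 - s) • opt p + s • opt p'
  have hy : y ∈ Metric.sphere (opt p) r := by
    have : y - opt p = s • (opt p' - opt p) := by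
      simp only [y]; module
    rw [Metric.mem_sphere, dist_eq_norm, this, norm_smul, Real.norm_of_nonneg hs0.le,
      ← dist_eq_norm, ← hd_def]
    exact div_mul_cancel₀ _ hd0.ne'
  have hle : h p' y ≤ (1 - s) • h p' (opt p) + s • h p' (opt p') :=
    (hconv p').convexOn.2 (hopt p) (hopt p') (by linarith) hs0.le (by ring)
  have := hmin p' (hopt p)
  simp only [Set.mem_ofPred_eq] at this
  have h3 := hp' y hy
  simp only [smul_eq_mul] at hle
  nlinarith

/-! ### Trace and order inequalities for Hermitian matrices. -/

section MatrixInequalities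

open scoped Matrix.Norms.L2Operator MatrixOrder

variable {k : ℕ}

theorem _root_.Matrix.PosSemidef.exists_eq_conjTranspose_mul_self {M : Matrix (Fin k) (Fin k) ℂ}
    (hM : M.PosSemidef) : ∃ C : Matrix (Fin k) (Fin k) ℂ, M = Cᴴ * C :=
  CStarAlgebra.nonneg_iff_eq_star_mul_self.1 hM.nonneg

theorem trace_mul_re_nonneg {M N : Matrix (Fin k) (Fin k) ℂ} (hM : M.PosSemidef)
    (hN : N.PosSemidef) : 0 ≤ (M * N).trace.re := by
  obtain ⟨C, rfl⟩ := hM.exists_eq_conjTranspose_mul_self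
  rw [Matrix.mul_assoc, Matrix.trace_mul_comm]
  exact (Complex.le_def.1 (hN.mul_mul_conjTranspose_same C).trace_nonneg).1

theorem eq_zero_of_trace_re_eq_zero {M : Matrix (Fin k) (Fin k) ℂ} (hM : M.PosSemidef)
    (h : M.trace.re = 0) : M = 0 := by
  obtain ⟨C, rfl⟩ := hM.exists_eq_conjTranspose_mul_self
  have h0 := Complex.le_def.1 hM.trace_nonneg
  have : (Cᴴ * C).trace = 0 := Complex.ext h h0.2.symm
  rw [Matrix.trace_conjTranspose_mul_self_eq_zero_iff] at this
  simp [this]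

/-- Coercivity enters only in this form, both for Ψ ≥ a and for the positive density representing Σ.
-/
theorem smul_trace_re_le_trace_mul_re {M N : Matrix (Fin k) (Fin k) ℂ} {a : ℝ}
    (hM : M.PosSemidef) (hN : (N - (a : ℂ) • (1 : Matrix (Fin k) (Fin k) ℂ)).PosSemidef) :
    a * M.trace.re ≤ (M * N).trace.re := by
  have := trace_mul_re_nonneg hM hN
  simp only [mul_sub, Matrix.mul_smul, mul_one, Matrix.trace_sub, Matrix.trace_smul, smul_eq_mul,
    Complex.sub_re, Complex.re_ofReal_mul] at this
  linarith

theorem posSemidef_ofReal_smul_one {a : ℝ} (ha : 0 ≤ a) :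
    ((a : ℂ) • (1 : Matrix (Fin k) (Fin k) ℂ)).PosSemidef :=
  Matrix.PosSemidef.one.smul (by exact_mod_cast ha)

theorem posSemidef_norm_smul_one_sub {M : Matrix (Fin k) (Fin k) ℂ} (hM : M.IsHermitian) :
    ((‖M‖ : ℂ) • (1 : Matrix (Fin k) (Fin k) ℂ) - M).PosSemidef := by
  have := IsSelfAdjoint.le_algebraMap_norm_self (a := M) hM
  rw [Matrix.le_iff, Algebra.algebraMap_eq_smul_one] at this
  exact this

theorem posDef_of_posSemidef_sub {M : Matrix (Fin k) (Fin k) ℂ} {ε : ℝ} (hε : 0 < ε)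
    (h : (M - (ε : ℂ) • (1 : Matrix (Fin k) (Fin k) ℂ)).PosSemidef) : M.PosDef := by
  have h1 : ((ε : ℂ) • (1 : Matrix (Fin k) (Fin k) ℂ)).PosDef :=
    Matrix.PosDef.one.smul (by exact_mod_cast hε)
  simpa using h1.posSemidef_add h

/-- Completion of the square for the inverse. -/
theorem inv_sub_eq_conj {X W : Matrix (Fin k) (Fin k) ℂ} (hX : X.PosDef) (hW : W.IsHermitian) :
    X⁻¹ - W - W + W * X * W = (X⁻¹ - W)ᴴ * X * (X⁻¹ - W) := by
  have h1 : X⁻¹ * X = 1 := Matrix.nonsing_inv_mul X ((Matrix.isUnit_iff_isUnit_det X).1 hX.isUnit)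
  have h2 : X * X⁻¹ = 1 := Matrix.mul_nonsing_inv X ((Matrix.isUnit_iff_isUnit_det X).1 hX.isUnit)
  rw [Matrix.conjTranspose_sub, hW.eq, hX.inv.isHermitian.eq]
  simp only [sub_mul, mul_sub, h1, mul_assoc, h2, one_mul, mul_one]
  abel

theorem continuous_inv_of_posDef {X : Type*} [TopologicalSpace X]
    {F : X → Matrix (Fin k) (Fin k) ℂ} (hF : Continuous F) (hpos : ∀ x, (F x).PosDef) :
    Continuous fun x => (F x)⁻¹ := by
  rw [continuous_iff_continuousAt]
  intro x
  refine ContinuousAt.comp (f := F) (g := Inv.inv) (continuousAt_matrix_inv _ ?_) hF.continuousAt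
  rw [Ring.inverse_eq_inv']
  exact continuousAt_inv₀ (by
    simpa using (Matrix.isUnit_iff_isUnit_det _).1 (hpos x).isUnit)

/-- A continuous family of positive definite matrices over a compact space is uniformly positive
definite. -/
theorem exists_uniform_lower_bound {X : Type*} [TopologicalSpace X] [CompactSpace X]
    {F : X → Matrix (Fin k) (Fin k) ℂ} (hF : Continuous F) (hpos : ∀ x, (F x).PosDef) :
    ∃ ε : ℝ, 0 < ε ∧
      ∀ x, (F x - (ε : ℂ) • (1 : Matrix (Fin k) (Fin k) ℂ)).PosSemidef := by
  have hinv := continuous_inv_of_posDef hF hpos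
  obtain ⟨C, hC⟩ := (isCompact_range hinv).isBounded.exists_norm_le
  -- The maximum with 1 makes the bound positive, also over an empty space.
  set D := max C 1
  have hD : 0 < D := by positivity
  refine ⟨D⁻¹, by positivity, fun x => ?_⟩
  have hx : ‖(F x)⁻¹‖ ≤ D := (hC _ ⟨x, rfl⟩).trans (le_max_left _ _)
  have hW : ((D⁻¹ : ℂ) • (F x)⁻¹).IsHermitian := by
    have := (hpos x).inv.isHermitian
    rw [Matrix.IsHermitian, Matrix.conjTranspose_smul, this.eq]
    simp
  have h1 : ((D : ℂ) • (1 : Matrix (Fin k) (Fin k) ℂ) - (F x)⁻¹).PosSemidef := by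
    have := (posSemidef_norm_smul_one_sub (hpos x).inv.isHermitian).add
      (posSemidef_ofReal_smul_one (k := k) (sub_nonneg.2 hx))
    convert this using 1
    push_cast
    module
  -- With W = D⁻¹F⁻¹, the identity F − D⁻¹ = (1 − W)*F(1 − W) + D⁻²(D − F⁻¹) exhibits both summands
  -- as positive semidefinite.
  have h2 := (hpos x).posSemidef.conjTranspose_mul_mul_same
    (1 - (D⁻¹ : ℂ) • (F x)⁻¹)
  have h3 := h2.add (h1.smul (a := ((D⁻¹ ^ 2 : ℝ) : ℂ)) (by
    rw [Complex.zero_le_real]; positivity))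
  convert h3 using 1
  have e1 : (F x)⁻¹ * F x = 1 :=
    Matrix.nonsing_inv_mul _ ((Matrix.isUnit_iff_isUnit_det _).1 (hpos x).isUnit)
  have e2 : F x * (F x)⁻¹ = 1 :=
    Matrix.mul_nonsing_inv _ ((Matrix.isUnit_iff_isUnit_det _).1 (hpos x).isUnit)
  have hD' : (D : ℂ) ≠ 0 := by exact_mod_cast hD.ne'
  rw [Matrix.conjTranspose_sub, hW.eq, Matrix.conjTranspose_one]
  simp only [sub_mul, mul_sub, one_mul, mul_one, Matrix.smul_mul, Matrix.mul_smul, e1, e2,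
    smul_sub, smul_smul]
  push_cast
  have : ((D : ℂ)⁻¹ ^ 2 * D) = (D : ℂ)⁻¹ := by field_simp
  rw [this]
  module

/-- Strict convexity, with a remainder, of `X ↦ tr X⁻¹ Ψ`. -/
theorem trace_inv_mul_convex {X Y Ψ : Matrix (Fin k) (Fin k) ℂ} (hX : X.PosDef) (hY : Y.PosDef)
    {a s t : ℝ} (ha : 0 ≤ a) (hs : 0 < s) (ht : 0 < t) (hst : s + t = 1)
    (hΨ : (Ψ - (a : ℂ) • (1 : Matrix (Fin k) (Fin k) ℂ)).PosSemidef) :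
    ((s • X + t • Y)⁻¹ * Ψ).trace.re +
        a * s * ((X⁻¹ - (s • X + t • Y)⁻¹)ᴴ * X * (X⁻¹ - (s • X + t • Y)⁻¹)).trace.re ≤
      s * (X⁻¹ * Ψ).trace.re + t * (Y⁻¹ * Ψ).trace.re := by
  have hZ : (s • X + t • Y).PosDef := by
    have h1 := hX.smul (a := (s : ℂ)) (by exact_mod_cast hs)
    have h2 := hY.smul (a := (t : ℂ)) (by exact_mod_cast ht)
    exact h1.add h2
  set Z := s • X + t • Y
  set W := Z⁻¹
  have hW : W.IsHermitian := hZ.inv.isHermitian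
  set DX := (X⁻¹ - W)ᴴ * X * (X⁻¹ - W)
  set DY := (Y⁻¹ - W)ᴴ * Y * (Y⁻¹ - W)
  have hDX : DX.PosSemidef := hX.posSemidef.conjTranspose_mul_mul_same _
  have hDY : DY.PosSemidef := hY.posSemidef.conjTranspose_mul_mul_same _
  have hΨ0 : Ψ.PosSemidef := by simpa using hΨ.add (posSemidef_ofReal_smul_one (k := k) ha)
  have h1 := smul_trace_re_le_trace_mul_re hDX hΨ
  have h2 := trace_mul_re_nonneg hDY hΨ0
  -- The completed square is affine in X apart from X⁻¹, so the quadratic terms average to WZW = W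
  -- and cancel one of the two copies of −W.
  have key : s • X⁻¹ + t • Y⁻¹ - W = s • DX + t • DY := by
    have eW : W * Z * W = W := by
      rw [Matrix.nonsing_inv_mul _ ((Matrix.isUnit_iff_isUnit_det _).1 hZ.isUnit), one_mul]
    have : W * Z * W = s • (W * X * W) + t • (W * Y * W) := by
      simp only [Z, mul_add, add_mul, Matrix.mul_smul, Matrix.smul_mul]
    simp only [DX, DY, ← inv_sub_eq_conj hX hW, ← inv_sub_eq_conj hY hW]
    have h4 : s • (W * X * W) + t • (W * Y * W) = W := by rw [← this, eW]
    have h5 : s • W + t • W = W := by rw [← add_smul, hst, one_smul]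
    calc s • X⁻¹ + t • Y⁻¹ - W
        = s • X⁻¹ + t • Y⁻¹ - (s • W + t • W) - (s • W + t • W)
          + (s • (W * X * W) + t • (W * Y * W)) := by rw [h4, h5]; abel
      _ = _ := by module
  have h3 := congrArg (fun M => (M * Ψ).trace.re) key
  simp only [sub_mul, add_mul, Matrix.smul_mul, Matrix.trace_sub, Matrix.trace_add,
    Matrix.trace_smul, Complex.sub_re, Complex.add_re, Complex.real_smul,
    Complex.re_ofReal_mul] at h3
  nlinarith [mul_le_mul_of_nonneg_left h1 hs.le, mul_nonneg ht.le h2]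

/-- Completing the square at W = q⁻¹vv* and taking traces gives tr X⁻¹ ≥ 2/q − v*Xv/q² ≥ 1/q. This
avoids diagonalizing X. -/
theorem le_trace_inv_re {X : Matrix (Fin k) (Fin k) ℂ} (hX : X.PosDef) {v : Fin k → ℂ}
    (hv : star v ⬝ᵥ v = 1) {q : ℝ} (hq : 0 < q) (hqv : (star v ⬝ᵥ X *ᵥ v).re ≤ q) :
    q⁻¹ ≤ X⁻¹.trace.re := by
  set W : Matrix (Fin k) (Fin k) ℂ := ((q⁻¹ : ℝ) : ℂ) • Matrix.vecMulVec v (star v)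
  have hW : W.IsHermitian :=
    ((Matrix.posSemidef_vecMulVec_self_star v).smul (by
      rw [Complex.zero_le_real]; positivity)).isHermitian
  have h := (Complex.le_def.1 (hX.posSemidef.conjTranspose_mul_mul_same (X⁻¹ - W)).trace_nonneg).1
  rw [← inv_sub_eq_conj hX hW] at h
  have t1 : W.trace = ((q⁻¹ : ℝ) : ℂ) := by
    simp only [W, Matrix.trace_smul, Matrix.trace_vecMulVec]
    rw [dotProduct_comm, hv]; simp
  have t2 : (W * X * W).trace = ((q⁻¹ : ℝ) : ℂ) * ((q⁻¹ : ℝ) : ℂ) * (star v ⬝ᵥ X *ᵥ v) := by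
    simp only [W, Matrix.smul_mul, Matrix.mul_smul, Matrix.trace_smul, smul_eq_mul, smul_smul]
    rw [Matrix.trace_mul_comm, ← Matrix.mul_assoc, Matrix.vecMulVec_mul_vecMulVec, hv]
    rw [one_smul, Matrix.trace_mul_comm, Matrix.mul_vecMulVec, Matrix.trace_vecMulVec,
      dotProduct_comm]
  simp only [Matrix.trace_add, Matrix.trace_sub, t1, t2, Complex.add_re, Complex.sub_re,
    Complex.zero_re, Complex.ofReal_re, ← Complex.ofReal_mul, Complex.re_ofReal_mul] at h
  have h2 : q⁻¹ * q⁻¹ * (star v ⬝ᵥ X *ᵥ v).re ≤ q⁻¹ := by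
    calc q⁻¹ * q⁻¹ * (star v ⬝ᵥ X *ᵥ v).re ≤ q⁻¹ * q⁻¹ * q := by gcongr
      _ = q⁻¹ := by field_simp
  linarith

theorem posSemidef_sub_of_unit {M : Matrix (Fin k) (Fin k) ℂ} (hM : M.IsHermitian) {ε : ℝ}
    (h : ∀ v : Fin k → ℂ, star v ⬝ᵥ v = 1 → ε ≤ (star v ⬝ᵥ M *ᵥ v).re) :
    (M - (ε : ℂ) • (1 : Matrix (Fin k) (Fin k) ℂ)).PosSemidef := by
  have hH : (M - (ε : ℂ) • (1 : Matrix (Fin k) (Fin k) ℂ)).IsHermitian := by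
    rw [Matrix.IsHermitian, Matrix.conjTranspose_sub, hM.eq]; simp
  refine Matrix.PosSemidef.of_dotProduct_mulVec_nonneg hH fun v => ?_
  have him := hH.im_star_dotProduct_mulVec_self v
  rw [Complex.le_def]
  refine ⟨?_, by simpa using him.symm⟩
  by_cases hv : v = 0
  · simp [hv]
  have hN := Matrix.dotProduct_star_self_pos_iff.2 hv
  rw [Complex.lt_def] at hN
  set N := (star v ⬝ᵥ v).re
  have hNv : star v ⬝ᵥ v = (N : ℂ) := Complex.ext rfl (by simpa using hN.2.symm)
  have hN0 : 0 < N := hN.1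
  have hsq : ((Real.sqrt N : ℝ) : ℂ)⁻¹ * ((Real.sqrt N : ℝ) : ℂ)⁻¹ = (N⁻¹ : ℝ) := by
    rw [← mul_inv, ← Complex.ofReal_mul, Real.mul_self_sqrt hN0.le, Complex.ofReal_inv]
  have := h (((Real.sqrt N : ℝ) : ℂ)⁻¹ • v) (by
    rw [star_smul, smul_dotProduct, dotProduct_smul, hNv, smul_smul]
    simp only [star_inv₀, Complex.star_def, Complex.conj_ofReal]
    rw [hsq, smul_eq_mul, ← Complex.ofReal_mul, inv_mul_cancel₀ hN0.ne', Complex.ofReal_one])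
  rw [Matrix.mulVec_smul, star_smul, smul_dotProduct, dotProduct_smul, smul_smul] at this
  simp only [star_inv₀, Complex.star_def, Complex.conj_ofReal] at this
  rw [hsq, smul_eq_mul, Complex.re_ofReal_mul] at this
  rw [Matrix.sub_mulVec, dotProduct_sub, Matrix.smul_mulVec, Matrix.one_mulVec, dotProduct_smul,
    hNv, smul_eq_mul]
  simp only [Complex.zero_re, Complex.sub_re, Complex.re_ofReal_mul, Complex.ofReal_re]
  have h2 := mul_le_mul_of_nonneg_left this hN0.le
  rw [← mul_assoc, mul_inv_cancel₀ hN0.ne', one_mul] at h2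
  linarith

theorem re_dotProduct_mulVec_le_norm {M : Matrix (Fin k) (Fin k) ℂ} (hM : M.IsHermitian)
    {v : Fin k → ℂ} (hv : star v ⬝ᵥ v = 1) : (star v ⬝ᵥ M *ᵥ v).re ≤ ‖M‖ := by
  have := ((posSemidef_norm_smul_one_sub hM).dotProduct_mulVec_nonneg v)
  rw [Complex.le_def] at this
  have := this.1
  rw [Matrix.sub_mulVec, dotProduct_sub, Matrix.smul_mulVec, Matrix.one_mulVec, dotProduct_smul,
    hv, smul_eq_mul, mul_one] at this
  simpa using this

/-- Equivalence of norms in finite dimension: it converts the operator norm, used for products, into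
the entrywise bounds that `circleMean` needs. -/
theorem exists_entry_norm_le (k l : ℕ) :
    ∃ c : ℝ, 0 ≤ c ∧ ∀ (M : Matrix (Fin k) (Fin l) ℂ) (i j), ‖M i j‖ ≤ c * ‖M‖ := by
  let f : Matrix (Fin k) (Fin l) ℂ →L[ℝ] (Fin k → Fin l → ℂ) :=
    LinearMap.toContinuousLinearMap
      { toFun := fun M => M, map_add' := fun _ _ => rfl, map_smul' := fun _ _ => rfl }
  refine ⟨‖f‖, f.opNorm_nonneg, fun M i j => ?_⟩
  calc ‖M i j‖ = ‖f M i j‖ := rfl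
    _ ≤ ‖f M i‖ := norm_le_pi_norm _ _
    _ ≤ ‖f M‖ := norm_le_pi_norm _ _
    _ ≤ _ := f.le_opNorm M

theorem norm_le_of_bounds {M : Matrix (Fin k) (Fin k) ℂ} {b : ℝ} (hM : M.PosSemidef)
    (hb : ((b : ℂ) • (1 : Matrix (Fin k) (Fin k) ℂ) - M).PosSemidef) :
    ‖M‖ ≤ ‖(b : ℂ) • (1 : Matrix (Fin k) (Fin k) ℂ)‖ :=
  CStarAlgebra.norm_le_norm_of_nonneg_of_le hM.nonneg (Matrix.le_iff.2 hb)

/-- Gelfand's formula: ‖M^j‖ ≤ r^j eventually, for some r < 1. Size 0 is separate because the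
spectrum is then empty. -/
theorem tendsto_pow_of_spectrum_norm_lt_one {M : Matrix (Fin k) (Fin k) ℂ}
    (hM : IsStabilityMatrix M) : Filter.Tendsto (fun j => M ^ j) Filter.atTop (nhds 0) := by
  rcases isEmpty_or_nonempty (Fin k) with he | he
  · have : ∀ N : Matrix (Fin k) (Fin k) ℂ, N = 0 := fun N => Subsingleton.elim _ _
    simp only [fun j => this (M ^ j), tendsto_const_nhds]
  have hr : spectralRadius ℂ M < ((1 : NNReal) : ENNReal) :=
    spectrum.spectralRadius_lt_of_forall_lt M fun z hz => by
      rw [← NNReal.coe_lt_coe]; simpa using hM z hz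
  obtain ⟨r, hr1, hr2⟩ := ENNReal.lt_iff_exists_nnreal_btwn.1 hr
  have hev := (spectrum.pow_nnnorm_pow_one_div_tendsto_nhds_spectralRadius M).eventually
    (gt_mem_nhds hr1)
  have hr2' : r < 1 := by exact_mod_cast hr2
  refine squeeze_zero_norm' ?_ (tendsto_pow_atTop_nhds_zero_of_lt_one (r := (r : ℝ)) r.2
    (by exact_mod_cast hr2'))
  filter_upwards [hev, Filter.eventually_gt_atTop 0] with j hj hj0
  have hj' : (0 : ℝ) < j := by exact_mod_cast hj0
  have h1 := ENNReal.rpow_le_rpow hj.le hj'.le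
  rw [← ENNReal.rpow_mul, one_div, inv_mul_cancel₀ hj'.ne', ENNReal.rpow_one,
    ENNReal.rpow_natCast] at h1
  exact_mod_cast h1

end MatrixInequalities

/-! ### Calculus of means over the unit circle. -/

section CircleMean

variable {k l p : ℕ}

/-- Entrywise integrability over the unit circle. -/
def MeanIntegrable (F : Circle → Matrix (Fin k) (Fin l) ℂ) : Prop :=
  ∀ i j, IntervalIntegrable (fun θ : ℝ => F (Circle.exp θ) i j) volume 0 (2 * Real.pi)

theorem _root_.Continuous.meanIntegrable {F : Circle → Matrix (Fin k) (Fin l) ℂ}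
    (hF : Continuous F) : MeanIntegrable F := fun i j =>
  Continuous.intervalIntegrable ((hF.comp Circle.exp.continuous).matrix_elem i j) _ _

theorem circleMean_add {F H : Circle → Matrix (Fin k) (Fin l) ℂ} (hF : MeanIntegrable F)
    (hH : MeanIntegrable H) :
    circleMean (fun z => F z + H z) = circleMean F + circleMean H := by
  ext i j
  simp only [circleMean, Matrix.of_apply, Matrix.add_apply]
  rw [intervalIntegral.integral_add (hF i j) (hH i j), mul_add]

theorem circleMean_sub {F H : Circle → Matrix (Fin k) (Fin l) ℂ} (hF : MeanIntegrable F)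
    (hH : MeanIntegrable H) :
    circleMean (fun z => F z - H z) = circleMean F - circleMean H := by
  ext i j
  simp only [circleMean, Matrix.of_apply, Matrix.sub_apply]
  rw [intervalIntegral.integral_sub (hF i j) (hH i j), mul_sub]

theorem circleMean_smul (c : ℝ) (F : Circle → Matrix (Fin k) (Fin l) ℂ) :
    circleMean (fun z => c • F z) = c • circleMean F := by
  ext i j
  simp only [circleMean, Matrix.of_apply, Matrix.smul_apply]
  rw [intervalIntegral.integral_smul, mul_smul_comm]

theorem circleMean_conjTranspose (F : Circle → Matrix (Fin k) (Fin l) ℂ) :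
    circleMean (fun z => (F z)ᴴ) = (circleMean F)ᴴ := by
  ext i j
  simp only [circleMean, Matrix.of_apply, Matrix.conjTranspose_apply, star_mul']
  congr 1
  · rw [star_inv₀, Complex.star_def, Complex.conj_ofReal]
  · exact intervalIntegral.intervalIntegral_conj

theorem circleMean_const (M : Matrix (Fin k) (Fin l) ℂ) : circleMean (fun _ => M) = M := by
  ext i j
  have : (2 * (Real.pi : ℂ)) ≠ 0 := by
    simp [Real.pi_ne_zero]
  simp only [circleMean, Matrix.of_apply, intervalIntegral.integral_const, sub_zero,
    Complex.real_smul]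
  push_cast
  field_simp

theorem circleMean_mul_left (M : Matrix (Fin p) (Fin k) ℂ)
    {F : Circle → Matrix (Fin k) (Fin l) ℂ} (hF : MeanIntegrable F) :
    circleMean (fun z => M * F z) = M * circleMean F := by
  ext i j
  simp only [circleMean, Matrix.of_apply, Matrix.mul_apply]
  rw [intervalIntegral.integral_finsetSum fun x _ => (hF x j).const_mul _, Finset.mul_sum]
  refine Finset.sum_congr rfl fun x _ => ?_
  rw [intervalIntegral.integral_const_mul]
  ring

theorem circleMean_mul_right (M : Matrix (Fin l) (Fin p) ℂ)
    {F : Circle → Matrix (Fin k) (Fin l) ℂ} (hF : MeanIntegrable F) :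
    circleMean (fun z => F z * M) = circleMean F * M := by
  ext i j
  simp only [circleMean, Matrix.of_apply, Matrix.mul_apply]
  rw [intervalIntegral.integral_finsetSum fun x _ => (hF i x).mul_const _, Finset.mul_sum]
  refine Finset.sum_congr rfl fun x _ => ?_
  rw [intervalIntegral.integral_mul_const]
  ring

theorem norm_circleMean_apply_le {F : Circle → Matrix (Fin k) (Fin l) ℂ} {c : ℝ}
    (hF : ∀ z i j, ‖F z i j‖ ≤ c) (i j) : ‖circleMean F i j‖ ≤ c := by
  simp only [circleMean, Matrix.of_apply, norm_mul]
  have h := intervalIntegral.norm_integral_le_of_norm_le_const (a := 0) (b := 2 * Real.pi)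
    (f := fun θ : ℝ => F (Circle.exp θ) i j) fun θ _ => hF (Circle.exp θ) i j
  have hpi : 0 < 2 * Real.pi := by positivity
  rw [sub_zero, abs_of_pos hpi] at h
  rw [norm_inv, Complex.norm_real, Real.norm_of_nonneg hpi.le]
  calc _ ≤ (2 * Real.pi)⁻¹ * (c * (2 * Real.pi)) := by gcongr
    _ = c := by field_simp

/-- The normalized integral of a real function over the unit circle. -/
def realMean (f : Circle → ℝ) : ℝ :=
  (2 * Real.pi)⁻¹ * ∫ θ in (0 : ℝ)..(2 * Real.pi), f (Circle.exp θ)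

theorem MeanIntegrable.trace {F : Circle → Matrix (Fin k) (Fin k) ℂ} (hF : MeanIntegrable F) :
    IntervalIntegrable (fun θ : ℝ => (F (Circle.exp θ)).trace) volume 0 (2 * Real.pi) := by
  have h := IntervalIntegrable.sum (μ := volume) (a := 0) (b := 2 * Real.pi) Finset.univ
    (f := fun (i : Fin k) (θ : ℝ) => F (Circle.exp θ) i i) fun i _ => hF i i
  have he : (∑ i : Fin k, fun θ : ℝ => F (Circle.exp θ) i i) =
      fun θ : ℝ => (F (Circle.exp θ)).trace := by
    funext θ
    simp [Matrix.trace]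
  exact he ▸ h

theorem MeanIntegrable.trace_re {F : Circle → Matrix (Fin k) (Fin k) ℂ} (hF : MeanIntegrable F) :
    IntervalIntegrable (fun θ : ℝ => (F (Circle.exp θ)).trace.re) volume 0 (2 * Real.pi) :=
  ⟨hF.trace.1.re, hF.trace.2.re⟩

theorem circleMean_trace_re {F : Circle → Matrix (Fin k) (Fin k) ℂ} (hF : MeanIntegrable F) :
    (circleMean F).trace.re = realMean fun z => (F z).trace.re := by
  have h1 : (circleMean F).trace =
      ((2 * Real.pi : ℝ) : ℂ)⁻¹ * ∫ θ in (0 : ℝ)..(2 * Real.pi), (F (Circle.exp θ)).trace := by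
    simp only [Matrix.trace, Matrix.diag, circleMean, Matrix.of_apply]
    rw [intervalIntegral.integral_finsetSum fun i _ => hF i i, Finset.mul_sum]
  rw [h1, realMean, ← Complex.ofReal_inv, Complex.re_ofReal_mul]
  congr 1
  exact (Complex.reCLM.intervalIntegral_comp_comm hF.trace).symm

theorem realMean_add {f g : Circle → ℝ}
    (hf : IntervalIntegrable (fun θ : ℝ => f (Circle.exp θ)) volume 0 (2 * Real.pi))
    (hg : IntervalIntegrable (fun θ : ℝ => g (Circle.exp θ)) volume 0 (2 * Real.pi)) :
    realMean (fun z => f z + g z) = realMean f + realMean g := by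
  rw [realMean, intervalIntegral.integral_add hf hg, mul_add, realMean, realMean]

theorem realMean_const_mul (c : ℝ) (f : Circle → ℝ) :
    realMean (fun z => c * f z) = c * realMean f := by
  rw [realMean, intervalIntegral.integral_const_mul, realMean]
  ring

theorem realMean_mono_ae {f g : Circle → ℝ}
    (hf : IntervalIntegrable (fun θ : ℝ => f (Circle.exp θ)) volume 0 (2 * Real.pi))
    (hg : IntervalIntegrable (fun θ : ℝ => g (Circle.exp θ)) volume 0 (2 * Real.pi))
    (h : ∀ᵐ θ : ℝ, f (Circle.exp θ) ≤ g (Circle.exp θ)) : realMean f ≤ realMean g := by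
  unfold realMean
  gcongr
  exact intervalIntegral.integral_mono_ae (by positivity) hf hg h

theorem exists_exp_eq (z : Circle) : ∃ θ ∈ Set.Icc 0 (2 * Real.pi), Circle.exp θ = z := by
  obtain ⟨θ, hθ, h⟩ := Circle.periodic_exp.exists_mem_Ico₀ Real.two_pi_pos (Complex.arg z)
  exact ⟨θ, ⟨hθ.1, hθ.2.le⟩, by rw [← h, Circle.exp_arg]⟩

theorem realMean_pos {f : Circle → ℝ} (hf : Continuous f) (h0 : ∀ z, 0 ≤ f z) {z : Circle}
    (hz : 0 < f z) : 0 < realMean f := by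
  obtain ⟨θ, hθ, rfl⟩ := exists_exp_eq z
  refine mul_pos (by positivity) (intervalIntegral.integral_pos Real.two_pi_pos
    (hf.comp Circle.exp.continuous).continuousOn (fun _ _ => h0 _) ⟨θ, hθ, hz⟩)

end CircleMean

/-! ### The transfer function and the operator Γ. -/

section TransferFunction

open scoped Matrix.Norms.L2Operator

variable {n m : ℕ} {A : Matrix (Fin n) (Fin n) ℂ} (B : Matrix (Fin n) (Fin m) ℂ)

theorem isUnit_smul_one_sub (hA : IsStabilityMatrix A) (z : Circle) :
    IsUnit ((z : ℂ) • (1 : Matrix (Fin n) (Fin n) ℂ) - A) := by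
  by_contra h
  have := hA z (by rw [spectrum.mem_iff, Algebra.algebraMap_eq_smul_one]; exact h)
  rw [Circle.norm_coe] at this
  exact lt_irrefl _ this

theorem continuous_resolvent (hA : IsStabilityMatrix A) :
    Continuous fun z : Circle => ((z : ℂ) • (1 : Matrix (Fin n) (Fin n) ℂ) - A)⁻¹ := by
  have hc : Continuous fun z : Circle => (z : ℂ) • (1 : Matrix (Fin n) (Fin n) ℂ) - A := by
    fun_prop
  rw [continuous_iff_continuousAt]
  intro z
  refine ContinuousAt.comp (f := fun z : Circle => (z : ℂ) • (1 : Matrix (Fin n) (Fin n) ℂ) - A)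
    (g := Inv.inv) (continuousAt_matrix_inv _ ?_) hc.continuousAt
  rw [Ring.inverse_eq_inv']
  exact continuousAt_inv₀ (by
    simpa using (Matrix.isUnit_iff_isUnit_det _).1 (isUnit_smul_one_sub hA z))

theorem continuous_transferFun (hA : IsStabilityMatrix A) : Continuous (transferFun A B) :=
  (continuous_resolvent hA).matrix_mul continuous_const

theorem sub_mul_transferFun (hA : IsStabilityMatrix A) (z : Circle) :
    ((z : ℂ) • (1 : Matrix (Fin n) (Fin n) ℂ) - A) * transferFun A B z = B := by
  rw [transferFun, Matrix.mul_nonsing_inv_cancel_left _ _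
    ((Matrix.isUnit_iff_isUnit_det _).1 (isUnit_smul_one_sub hA z))]

/-- Modulo B, multiplication by A is multiplication by z. All later algebra with transfer functions
reduces to this relation. -/
theorem mul_transferFun (hA : IsStabilityMatrix A) (z : Circle) :
    A * transferFun A B z = (z : ℂ) • transferFun A B z - B := by
  have := sub_mul_transferFun B hA z
  rw [Matrix.sub_mul, Matrix.smul_mul, Matrix.one_mul] at this
  rw [eq_sub_iff_add_eq, add_comm, ← sub_eq_iff_eq_add.1 this]

theorem eq_transferFun_mul {p : ℕ} {B : Matrix (Fin n) (Fin m) ℂ} (hA : IsStabilityMatrix A) {z : Circle}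
    {U : Matrix (Fin n) (Fin p) ℂ} {V : Matrix (Fin m) (Fin p) ℂ}
    (h : ((z : ℂ) • (1 : Matrix (Fin n) (Fin n) ℂ) - A) * U = B * V) :
    transferFun A B z * V = U := by
  have h' := congrArg (fun M => ((z : ℂ) • (1 : Matrix (Fin n) (Fin n) ℂ) - A)⁻¹ * M) h
  rw [Matrix.nonsing_inv_mul_cancel_left _ _
    ((Matrix.isUnit_iff_isUnit_det _).1 (isUnit_smul_one_sub hA z))] at h'
  rw [transferFun, Matrix.mul_assoc]
  exact h'.symm

theorem exists_norm_le_of_continuous {p : ℕ} {F : Circle → Matrix (Fin n) (Fin p) ℂ}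
    (hF : Continuous F) : ∃ c : ℝ, 0 ≤ c ∧ ∀ z, ‖F z‖ ≤ c := by
  obtain ⟨c, hc⟩ := (isCompact_range hF).isBounded.exists_norm_le
  exact ⟨max c 0, le_max_right _ _, fun z => (hc _ ⟨z, rfl⟩).trans (le_max_left _ _)⟩

/-- From the resolvent identity and boundedness of the resolvent on the compact circle. -/
theorem exists_transferFun_lipschitz (hA : IsStabilityMatrix A) :
    ∃ c : ℝ, 0 ≤ c ∧ ∀ z w : Circle,
      ‖transferFun A B z - transferFun A B w‖ ≤ c * ‖(z : ℂ) - w‖ := by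
  obtain ⟨c, hc0, hc⟩ := exists_norm_le_of_continuous (continuous_resolvent hA)
  refine ⟨c * c * ‖B‖, by positivity, fun z w => ?_⟩
  have hz := (Matrix.isUnit_iff_isUnit_det _).1 (isUnit_smul_one_sub hA z)
  have hw := (Matrix.isUnit_iff_isUnit_det _).1 (isUnit_smul_one_sub hA w)
  have key : transferFun A B z - transferFun A B w =
      ((w : ℂ) - z) • (((z : ℂ) • (1 : Matrix (Fin n) (Fin n) ℂ) - A)⁻¹ *
        ((w : ℂ) • (1 : Matrix (Fin n) (Fin n) ℂ) - A)⁻¹ * B) := by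
    have : ((z : ℂ) • (1 : Matrix (Fin n) (Fin n) ℂ) - A)⁻¹ -
        ((w : ℂ) • (1 : Matrix (Fin n) (Fin n) ℂ) - A)⁻¹ =
        ((z : ℂ) • (1 : Matrix (Fin n) (Fin n) ℂ) - A)⁻¹ *
          (((w : ℂ) • (1 : Matrix (Fin n) (Fin n) ℂ) - A) -
            ((z : ℂ) • (1 : Matrix (Fin n) (Fin n) ℂ) - A)) *
          ((w : ℂ) • (1 : Matrix (Fin n) (Fin n) ℂ) - A)⁻¹ := by
      rw [Matrix.mul_sub, Matrix.nonsing_inv_mul _ hz, Matrix.sub_mul, Matrix.one_mul,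
        Matrix.mul_assoc, Matrix.mul_nonsing_inv _ hw, Matrix.mul_one]
    rw [transferFun, transferFun, ← Matrix.sub_mul, this, sub_sub_sub_cancel_right, ← sub_smul,
      Matrix.mul_smul, Matrix.mul_one, Matrix.smul_mul, Matrix.smul_mul]
  rw [key, norm_smul, norm_sub_rev (w : ℂ)]
  have h1 := Matrix.l2_opNorm_mul (((z : ℂ) • (1 : Matrix (Fin n) (Fin n) ℂ) - A)⁻¹ *
        ((w : ℂ) • (1 : Matrix (Fin n) (Fin n) ℂ) - A)⁻¹) B
  have h2 := Matrix.l2_opNorm_mul (((z : ℂ) • (1 : Matrix (Fin n) (Fin n) ℂ) - A)⁻¹)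
        (((w : ℂ) • (1 : Matrix (Fin n) (Fin n) ℂ) - A)⁻¹)
  calc _ ≤ ‖(z : ℂ) - w‖ * (c * c * ‖B‖) := by
        gcongr
        refine h1.trans ?_
        gcongr
        refine h2.trans ?_
        gcongr
        · exact hc z
        · exact hc w
    _ = _ := by ring

theorem norm_exp_sub_exp_le (s t : ℝ) :
    ‖(Circle.exp s : ℂ) - Circle.exp t‖ ≤ |s - t| := by
  rw [Circle.coe_exp, Circle.coe_exp]
  have : Complex.exp (s * Complex.I) - Complex.exp (t * Complex.I) =
      Complex.exp (t * Complex.I) * (Complex.exp (Complex.I * ((s - t : ℝ) : ℂ)) - 1) := by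
    rw [mul_sub, ← Complex.exp_add, mul_one]
    congr 2
    push_cast
    ring
  rw [this, norm_mul, Complex.norm_exp_ofReal_mul_I, one_mul]
  exact Real.norm_exp_I_mul_ofReal_sub_one_le

/-- The operator `Γ` as a real linear map. -/
def gammaLinear (hA : IsStabilityMatrix A) :
    C(Circle, selfAdjoint (Matrix (Fin m) (Fin m) ℂ)) →ₗ[ℝ] Matrix (Fin n) (Fin n) ℂ where
  toFun := gammaOp A B
  map_add' Φ Θ := by
    have hc : ∀ Φ : C(Circle, selfAdjoint (Matrix (Fin m) (Fin m) ℂ)),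
        Continuous fun z => transferFun A B z * (Φ z : Matrix (Fin m) (Fin m) ℂ) *
          (transferFun A B z)ᴴ := fun Φ =>
      ((continuous_transferFun B hA).matrix_mul (continuous_subtype_val.comp Φ.continuous)).matrix_mul
        (continuous_transferFun B hA).matrix_conjTranspose
    rw [gammaOp, gammaOp, gammaOp, ← circleMean_add (hc Φ).meanIntegrable (hc Θ).meanIntegrable]
    congr 1
    ext1 z
    rw [ContinuousMap.add_apply, AddSubgroup.coe_add, Matrix.mul_add, Matrix.add_mul]
  map_smul' c Φ := by
    rw [gammaOp, gammaOp, RingHom.id_apply, ← circleMean_smul]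
    congr 1
    ext1 z
    rw [ContinuousMap.smul_apply, selfAdjoint.val_smul, Matrix.mul_smul, Matrix.smul_mul]

variable {B}

theorem isHermitian_of_mem_range_gammaOp {S : Matrix (Fin n) (Fin n) ℂ}
    (hS : S ∈ Set.range (gammaOp A B)) : S.IsHermitian := by
  obtain ⟨Φ, rfl⟩ := hS
  rw [Matrix.IsHermitian, gammaOp, ← circleMean_conjTranspose]
  congr 1
  ext1 z
  have : ((Φ z : Matrix (Fin m) (Fin m) ℂ))ᴴ = Φ z := (Φ z).2
  rw [Matrix.conjTranspose_mul, Matrix.conjTranspose_mul, Matrix.conjTranspose_conjTranspose, this,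
    Matrix.mul_assoc]

/-- `⟨Λ, ∫ G Φ G*⟩ = ∫ ⟨G* Λ G, Φ⟩`. -/
theorem trace_mul_circleMean_re (hA : IsStabilityMatrix A)
    {Φ : Circle → Matrix (Fin m) (Fin m) ℂ} (hΦ : Continuous Φ) (L : Matrix (Fin n) (Fin n) ℂ) :
    (L * circleMean fun z => transferFun A B z * Φ z * (transferFun A B z)ᴴ).trace.re =
      realMean fun z => ((transferFun A B z)ᴴ * L * transferFun A B z * Φ z).trace.re := by
  have hG := continuous_transferFun B hA
  have hc : Continuous fun z => transferFun A B z * Φ z * (transferFun A B z)ᴴ :=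
    (hG.matrix_mul hΦ).matrix_mul hG.matrix_conjTranspose
  rw [← circleMean_mul_left _ hc.meanIntegrable,
    circleMean_trace_re (continuous_const.matrix_mul hc).meanIntegrable]
  congr 1
  ext1 z
  rw [← Matrix.mul_assoc, Matrix.trace_mul_comm]
  simp only [Matrix.mul_assoc]

end TransferFunction

/-! ### A positive definite density for every element of P_Γ. -/

section PositiveDensity

variable {n m : ℕ} {A : Matrix (Fin n) (Fin n) ℂ} {B : Matrix (Fin n) (Fin m) ℂ}

theorem circleMean_pow_inv_smul (M : Matrix (Fin n) (Fin m) ℂ) (j : ℕ) :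
    circleMean (fun z => ((z : ℂ)⁻¹ ^ (j + 1)) • M) = 0 := by
  have hc : -(((j + 1 : ℕ) : ℂ) * Complex.I) ≠ 0 := by
    simp only [ne_eq, neg_eq_zero, mul_eq_zero, Complex.I_ne_zero, or_false]
    exact_mod_cast Nat.succ_ne_zero j
  have key : ∫ θ in (0 : ℝ)..(2 * Real.pi), ((Circle.exp θ : ℂ)⁻¹ ^ (j + 1)) = 0 := by
    have : ∀ θ : ℝ, ((Circle.exp θ : ℂ)⁻¹ ^ (j + 1)) =
        Complex.exp (-(((j + 1 : ℕ) : ℂ) * Complex.I) * θ) := fun θ => by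
      rw [Circle.coe_exp, ← Complex.exp_neg, ← Complex.exp_nat_mul]
      congr 1
      ring
    simp only [this]
    rw [integral_exp_mul_complex hc]
    have h1 : -(((j + 1 : ℕ) : ℂ) * Complex.I) * ((2 * Real.pi : ℝ) : ℂ) =
        ((-(j + 1 : ℤ) : ℤ) : ℂ) * (2 * Real.pi * Complex.I) := by
      push_cast
      ring
    rw [h1, Complex.exp_int_mul_two_pi_mul_I]
    simp
  ext i l
  simp only [circleMean, Matrix.of_apply, Matrix.smul_apply, smul_eq_mul, Matrix.zero_apply]
  rw [intervalIntegral.integral_mul_const, key, zero_mul, mul_zero]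

open scoped Matrix.Norms.L2Operator in
/-- The zeroth Fourier coefficient of `z (z I - A)⁻¹ B`. -/
theorem circleMean_smul_transferFun (hA : IsStabilityMatrix A) (B : Matrix (Fin n) (Fin m) ℂ) :
    circleMean (fun z => (z : ℂ) • transferFun A B z) = B := by
  have hG := continuous_transferFun B hA
  have hz : Continuous fun z : Circle => (z : ℂ)⁻¹ :=
    continuous_subtype_val.inv₀ fun z => Circle.coe_ne_zero z
  have hc : ∀ j : ℕ, Continuous fun z : Circle => ((z : ℂ)⁻¹ ^ j) • transferFun A B z :=
    fun j => (hz.pow j).smul hG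
  -- `E j` is the mean of z⁻ʲG. The relation AG = zG − B gives `E j = A * E (j + 1)`, so `E 0 = A ^
  -- j * E j`; this tends to 0 because the `E j` are bounded.
  set E : ℕ → Matrix (Fin n) (Fin m) ℂ :=
    fun j => circleMean fun z => ((z : ℂ)⁻¹ ^ j) • transferFun A B z
  have h0 : circleMean (fun z => (z : ℂ) • transferFun A B z) = A * E 0 + B := by
    have : (fun z : Circle => (z : ℂ) • transferFun A B z) =
        fun z : Circle => A * (((z : ℂ)⁻¹ ^ 0) • transferFun A B z) + B := by
      funext z
      rw [pow_zero, one_smul, mul_transferFun B hA]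
      abel
    rw [this, circleMean_add (continuous_const.matrix_mul (hc 0)).meanIntegrable
      continuous_const.meanIntegrable, circleMean_mul_left _ (hc 0).meanIntegrable,
      circleMean_const]
  have hstep : ∀ j, E j = A * E (j + 1) := by
    intro j
    have : (fun z : Circle => ((z : ℂ)⁻¹ ^ j) • transferFun A B z) =
        fun z : Circle => A * (((z : ℂ)⁻¹ ^ (j + 1)) • transferFun A B z) + ((z : ℂ)⁻¹ ^ (j + 1)) • B := by
      funext z
      rw [Matrix.mul_smul, mul_transferFun B hA, smul_sub, smul_smul, pow_succ, mul_assoc,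
        inv_mul_cancel₀ (Circle.coe_ne_zero z), mul_one]
      abel
    simp only [E]
    rw [this, circleMean_add (F := fun z => A * (((z : ℂ)⁻¹ ^ (j + 1)) • transferFun A B z))
      (H := fun z => ((z : ℂ)⁻¹ ^ (j + 1)) • B)
      (continuous_const.matrix_mul (hc (j + 1))).meanIntegrable
      ((hz.pow (j + 1)).smul continuous_const).meanIntegrable,
      circleMean_mul_left _ (hc (j + 1)).meanIntegrable, circleMean_pow_inv_smul, add_zero]
  have hiter : ∀ j, E 0 = A ^ j * E j := by
    intro j
    induction j with
    | zero => simp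
    | succ j ih => rw [ih, hstep j, pow_succ, Matrix.mul_assoc]
  obtain ⟨c, hc0, hcb⟩ := exists_norm_le_of_continuous hG
  obtain ⟨d, hd0, hd⟩ := exists_entry_norm_le n m
  have hEb : ∀ j i l, ‖E j i l‖ ≤ d * c := by
    intro j
    refine norm_circleMean_apply_le fun z i l => ?_
    rw [Matrix.smul_apply, norm_smul, norm_pow, norm_inv, Circle.norm_coe, inv_one, one_pow,
      one_mul]
    exact (hd _ i l).trans (by gcongr; exact hcb z)
  have hE0 : E 0 = 0 := by
    ext i l
    have hpow := tendsto_pow_of_spectrum_norm_lt_one hA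
    have hlim : Filter.Tendsto (fun j : ℕ => ∑ x, ‖(A ^ j) i x‖ * (d * c)) Filter.atTop
        (nhds (∑ _x : Fin n, ‖(0 : Matrix (Fin n) (Fin n) ℂ) i _x‖ * (d * c))) := by
      refine tendsto_finsetSum _ fun x _ => Filter.Tendsto.mul_const _ (Filter.Tendsto.norm ?_)
      exact ((continuous_id.matrix_elem i x).tendsto _).comp hpow
    have hle : ∀ j : ℕ, ‖E 0 i l‖ ≤ ∑ x, ‖(A ^ j) i x‖ * (d * c) := fun j => by
      rw [hiter j, Matrix.mul_apply]
      refine (norm_sum_le _ _).trans (Finset.sum_le_sum fun x _ => ?_)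
      rw [norm_mul]
      gcongr
      exact hEb j x l
    have := ge_of_tendsto' hlim hle
    simpa using this
  rw [h0, hE0, Matrix.mul_zero, zero_add]

/-- Iterating gives D = MʲD(Mʲ)*, which tends to 0. This is uniqueness for the Lyapunov equation. -/
theorem eq_zero_of_lyapunov {M D : Matrix (Fin n) (Fin n) ℂ} (hM : IsStabilityMatrix M)
    (h : D = M * D * Mᴴ) : D = 0 := by
  have hiter : ∀ j : ℕ, D = M ^ j * D * (M ^ j)ᴴ := by
    intro j
    induction j with
    | zero => simp
    | succ j ih =>
      calc D = M ^ j * (M * D * Mᴴ) * (M ^ j)ᴴ := by rw [← h]; exact ih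
        _ = _ := by rw [pow_succ, Matrix.conjTranspose_mul]; simp only [Matrix.mul_assoc]
  have hpow := tendsto_pow_of_spectrum_norm_lt_one hM
  have hcont : Continuous fun N : Matrix (Fin n) (Fin n) ℂ => N * D * Nᴴ := by fun_prop
  have h1 := (hcont.tendsto 0).comp hpow
  rw [Matrix.zero_mul, Matrix.zero_mul] at h1
  exact tendsto_nhds_unique (tendsto_const_nhds.congr hiter) h1

/-- If `S = M S M* + B N B*` with `S, N > 0` and the unobservable modes of `M` are stable, then `M`
is stable. -/
theorem isStabilityMatrix_of_lyapunov {M S : Matrix (Fin n) (Fin n) ℂ}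
    {N : Matrix (Fin m) (Fin m) ℂ} (hS : S.PosDef) (hN : N.PosDef)
    (h : S = M * S * Mᴴ + B * N * Bᴴ)
    (hun : ∀ (μ : ℂ) (x : Fin n → ℂ), x ≠ 0 → Mᴴ *ᵥ x = star μ • x → Bᴴ *ᵥ x = 0 → ‖μ‖ < 1) :
    IsStabilityMatrix M := by
  intro μ hμ
  have hdet : (μ • (1 : Matrix (Fin n) (Fin n) ℂ) - M).det = 0 := by
    rw [spectrum.mem_iff, Algebra.algebraMap_eq_smul_one, Matrix.isUnit_iff_isUnit_det,
      isUnit_iff_ne_zero, not_not] at hμ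
    exact hμ
  obtain ⟨v, hv0, hv⟩ := Matrix.exists_vecMul_eq_zero_iff.2 hdet
  set x := star v with hx_def
  have hx0 : x ≠ 0 := by rwa [hx_def, ne_eq, star_eq_zero]
  have hx : Mᴴ *ᵥ x = star μ • x := by
    rw [Matrix.vecMul_sub, Matrix.vecMul_smul, Matrix.vecMul_one, sub_eq_zero] at hv
    rw [hx_def, Matrix.mulVec_conjTranspose, star_star, ← hv, star_smul]
  -- Testing the Lyapunov equation on a left eigenvector yields (1 − |μ|²) x*Sx = (B*x)*N(B*x),
  -- positive unless B*x = 0.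
  have hquad : star x ⬝ᵥ S *ᵥ x = (star μ * μ) * (star x ⬝ᵥ S *ᵥ x) +
      star (Bᴴ *ᵥ x) ⬝ᵥ N *ᵥ (Bᴴ *ᵥ x) := by
    have e1 : star x ⬝ᵥ (M * S * Mᴴ) *ᵥ x = (star μ * μ) * (star x ⬝ᵥ S *ᵥ x) := by
      rw [← Matrix.mulVec_mulVec, hx, Matrix.mulVec_smul, ← Matrix.mulVec_mulVec,
        dotProduct_smul, Matrix.dotProduct_mulVec (star x) M]
      have : star x ᵥ* M = μ • star x := by
        have := congrArg star hx
        rwa [Matrix.star_mulVec, Matrix.conjTranspose_conjTranspose, star_smul,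
          star_star μ] at this
      rw [this, smul_dotProduct, smul_smul, smul_eq_mul]
    have e2 : star x ⬝ᵥ (B * N * Bᴴ) *ᵥ x = star (Bᴴ *ᵥ x) ⬝ᵥ N *ᵥ (Bᴴ *ᵥ x) := by
      rw [← Matrix.mulVec_mulVec, ← Matrix.mulVec_mulVec, Matrix.dotProduct_mulVec (star x) B,
        Matrix.star_mulVec, Matrix.conjTranspose_conjTranspose]
    rw [← e1, ← e2, ← dotProduct_add, ← Matrix.add_mulVec, ← h]
  by_cases hBx : Bᴴ *ᵥ x = 0
  · exact hun μ x hx0 hx hBx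
  · have hs := (Complex.lt_def.1 (hS.dotProduct_mulVec_pos hx0)).1
    have hb := (Complex.lt_def.1 (hN.dotProduct_mulVec_pos hBx)).1
    have hμ2 : star μ * μ = ((‖μ‖ ^ 2 : ℝ) : ℂ) := by
      rw [Complex.star_def, Complex.conj_mul']
      push_cast
      rfl
    rw [hμ2] at hquad
    have hre := congrArg Complex.re hquad
    rw [Complex.add_re, Complex.re_ofReal_mul] at hre
    rw [Complex.zero_re] at hs hb
    have : ‖μ‖ ^ 2 < 1 := by
      by_contra! hcon
      nlinarith
    exact (sq_lt_one_iff₀ (norm_nonneg _)).1 this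

/-- Every positive definite matrix in the range of `Γ` is the image of a continuous positive
definite density. -/
theorem exists_posDef_density (hA : IsStabilityMatrix A) (hB : Function.Injective B.mulVec)
    {S : Matrix (Fin n) (Fin n) ℂ} (hS : S ∈ PGamma A B) :
    ∃ Φ : Circle → Matrix (Fin m) (Fin m) ℂ, Continuous Φ ∧ (∀ z, (Φ z).PosDef) ∧
      circleMean (fun z => transferFun A B z * Φ z * (transferFun A B z)ᴴ) = S := by
  obtain ⟨⟨Φ₀, hΦ₀⟩, hSpos⟩ := hS
  have hG := continuous_transferFun B hA
  have hT : (Bᴴ * S⁻¹ * B).PosDef := hSpos.inv.conjTranspose_mul_mul_same hB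
  have hTu := (Matrix.isUnit_iff_isUnit_det _).1 hT.isUnit
  have hSu := (Matrix.isUnit_iff_isUnit_det _).1 hSpos.isUnit
  -- N and K are chosen so that KB = I and KS = NB*. Then P = I − BK is an oblique projection that
  -- kills B, with PSP* = S − BNB*.
  set N := (Bᴴ * S⁻¹ * B)⁻¹
  have hN : N.PosDef := hT.inv
  set K := N * Bᴴ * S⁻¹
  have hKB : K * B = 1 := by
    calc K * B = N * (Bᴴ * S⁻¹ * B) := by simp only [K, Matrix.mul_assoc]
      _ = 1 := Matrix.nonsing_inv_mul _ hTu
  have hKS : K * S = N * Bᴴ := by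
    simp only [K]
    rw [Matrix.nonsing_inv_mul_cancel_right _ _ hSu]
  have hSK : S * Kᴴ = B * N := by
    have := congrArg Matrix.conjTranspose hKS
    rwa [Matrix.conjTranspose_mul, Matrix.conjTranspose_mul N, hSpos.isHermitian.eq,
      hN.isHermitian.eq, Matrix.conjTranspose_conjTranspose] at this
  set P := 1 - B * K
  have hPB : P * B = 0 := by
    simp only [P, Matrix.sub_mul, Matrix.one_mul, Matrix.mul_assoc, hKB, Matrix.mul_one, sub_self]
  have hPSP : P * S * Pᴴ = S - B * N * Bᴴ := by
    have e1 : P * S = S - B * N * Bᴴ := by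
      simp only [P, Matrix.sub_mul, Matrix.one_mul, Matrix.mul_assoc, hKS]
    have e2 : Pᴴ = 1 - Kᴴ * Bᴴ := by
      simp only [P, Matrix.conjTranspose_sub, Matrix.conjTranspose_one, Matrix.conjTranspose_mul]
    have e3 : Bᴴ * Kᴴ = 1 := by rw [← Matrix.conjTranspose_mul, hKB, Matrix.conjTranspose_one]
    rw [e1, e2, Matrix.mul_sub, Matrix.mul_one, Matrix.sub_mul, ← Matrix.mul_assoc S, hSK,
      Matrix.mul_assoc (B * N), ← Matrix.mul_assoc Bᴴ, e3, Matrix.one_mul, sub_self, sub_zero]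
  set M := P * A with hM_def
  have hMG : ∀ z, M * transferFun A B z = (z : ℂ) • (P * transferFun A B z) := fun z => by
    rw [hM_def, Matrix.mul_assoc, mul_transferFun B hA, Matrix.mul_sub, hPB, sub_zero,
      Matrix.mul_smul]
  have hzz : ∀ z : Circle, (z : ℂ) * star (z : ℂ) = 1 := fun z => by
    rw [Complex.star_def, Complex.mul_conj', Circle.norm_coe]
    simp
  -- Since P kills B, MG = zPG, and the unimodular factor z cancels in the mean: MSM* = PSP*. Here
  -- membership of S in Range Γ is used, without any sign of `Φ₀`.
  have hlyap : S = M * S * Mᴴ + B * N * Bᴴ := by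
    have hc : Continuous fun z => transferFun A B z * (Φ₀ z : Matrix (Fin m) (Fin m) ℂ) *
        (transferFun A B z)ᴴ :=
      (hG.matrix_mul (continuous_subtype_val.comp Φ₀.continuous)).matrix_mul
        hG.matrix_conjTranspose
    have hmean : ∀ X : Matrix (Fin n) (Fin n) ℂ, X * S * Xᴴ = circleMean fun z =>
        (X * transferFun A B z) * (Φ₀ z : Matrix (Fin m) (Fin m) ℂ) *
          (X * transferFun A B z)ᴴ := fun X => by
      rw [← hΦ₀, gammaOp, ← circleMean_mul_left X hc.meanIntegrable,
        ← circleMean_mul_right Xᴴ (continuous_const.matrix_mul hc).meanIntegrable]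
      simp only [Matrix.conjTranspose_mul, Matrix.mul_assoc]
    have : M * S * Mᴴ = P * S * Pᴴ := by
      rw [hmean, hmean]
      congr 1
      funext z
      rw [hMG, Matrix.conjTranspose_smul, Matrix.mul_smul, Matrix.smul_mul, Matrix.smul_mul,
        smul_smul, mul_comm, hzz, one_smul]
    rw [this, hPSP]
    abel
  have hM : IsStabilityMatrix M := by
    refine isStabilityMatrix_of_lyapunov hSpos hN hlyap fun μ x hx0 hx hBx => ?_
    -- A mode with B*x = 0 is fixed by P*, hence is a mode of A, which is stable.
    have hPx : Pᴴ *ᵥ x = x := by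
      simp only [P, Matrix.conjTranspose_sub, Matrix.conjTranspose_one, Matrix.conjTranspose_mul,
        Matrix.sub_mulVec, Matrix.one_mulVec, ← Matrix.mulVec_mulVec, hBx, Matrix.mulVec_zero,
        sub_zero]
    rw [hM_def, Matrix.conjTranspose_mul, ← Matrix.mulVec_mulVec, hPx] at hx
    refine hA μ ?_
    rw [spectrum.mem_iff, Algebra.algebraMap_eq_smul_one, Matrix.isUnit_iff_isUnit_det,
      isUnit_iff_ne_zero, not_not]
    refine Matrix.exists_vecMul_eq_zero_iff.1 ⟨star x, by rwa [ne_eq, star_eq_zero], ?_⟩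
    have := congrArg star hx
    rw [Matrix.star_mulVec, Matrix.conjTranspose_conjTranspose, star_smul, star_star] at this
    rw [Matrix.vecMul_sub, Matrix.vecMul_smul, Matrix.vecMul_one, this, sub_self]
  set u : Circle → Matrix (Fin n) (Fin m) ℂ := fun z => (z : ℂ) • transferFun M B z with hu_def
  have hu : Continuous u := continuous_subtype_val.smul (continuous_transferFun B hM)
  have hMu : ∀ z, M * u z = (z : ℂ) • (u z - B) := fun z => by
    rw [hu_def, Matrix.mul_smul, mul_transferFun B hM]
  have hmu : circleMean u = B := circleMean_smul_transferFun hM B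
  -- As Mu = z(u − B) and u has mean B, the mean X of uNu* satisfies MXM* = X − BNB*, the equation
  -- already solved by S.
  have hX : circleMean (fun z => u z * N * (u z)ᴴ) = S := by
    have hc1 : Continuous fun z => u z * N := hu.matrix_mul continuous_const
    have hc : Continuous fun z => u z * N * (u z)ᴴ := hc1.matrix_mul hu.matrix_conjTranspose
    have hc2 : Continuous fun z => u z * (N * Bᴴ) := hu.matrix_mul continuous_const
    have hc3 : Continuous fun z => (B * N) * (u z)ᴴ :=
      continuous_const.matrix_mul hu.matrix_conjTranspose
    set X := circleMean fun z => u z * N * (u z)ᴴ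
    have hXl : M * X * Mᴴ = X - B * (N * Bᴴ) - (B * N * Bᴴ - B * N * Bᴴ) := by
      have : (fun z => M * (u z * N * (u z)ᴴ) * Mᴴ) = fun z =>
          (u z * N * (u z)ᴴ - u z * (N * Bᴴ)) - ((B * N) * (u z)ᴴ - B * N * Bᴴ) := by
        funext z
        have e : M * (u z * N * (u z)ᴴ) * Mᴴ = (M * u z) * N * (M * u z)ᴴ := by
          simp only [Matrix.conjTranspose_mul, Matrix.mul_assoc]
        rw [e, hMu, Matrix.conjTranspose_smul, Matrix.mul_smul, Matrix.smul_mul, Matrix.smul_mul,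
          smul_smul, mul_comm, hzz, one_smul, Matrix.conjTranspose_sub]
        simp only [Matrix.sub_mul, Matrix.mul_sub, Matrix.mul_assoc]
        abel
      rw [← circleMean_mul_left M hc.meanIntegrable,
        ← circleMean_mul_right Mᴴ (continuous_const.matrix_mul hc).meanIntegrable, this,
        circleMean_sub (F := fun z => u z * N * (u z)ᴴ - u z * (N * Bᴴ))
          (H := fun z => (B * N) * (u z)ᴴ - B * N * Bᴴ)
          (hc.sub hc2).meanIntegrable (hc3.sub continuous_const).meanIntegrable,
        circleMean_sub hc.meanIntegrable hc2.meanIntegrable,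
        circleMean_sub hc3.meanIntegrable continuous_const.meanIntegrable, circleMean_const,
        circleMean_mul_right _ hu.meanIntegrable, circleMean_mul_left _
        hu.matrix_conjTranspose.meanIntegrable, circleMean_conjTranspose, hmu]
    refine sub_eq_zero.1 (eq_zero_of_lyapunov hM ?_)
    rw [Matrix.mul_sub, Matrix.sub_mul, hXl, eq_sub_of_add_eq hlyap.symm, Matrix.mul_assoc B]
    abel
  -- Writing A = M + BKA gives (zI − A)u = B(zI − KAu), which dictates this factor.
  set R : Circle → Matrix (Fin m) (Fin m) ℂ := fun z => (z : ℂ) • 1 - K * A * u z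
  have hRz : ∀ z, R z = (z : ℂ) • 1 - K * A * u z := fun _ => rfl
  have hR : Continuous R :=
    (continuous_subtype_val.smul continuous_const).sub (continuous_const.matrix_mul hu)
  have hGR : ∀ z, transferFun A B z * R z = u z := fun z => by
    refine eq_transferFun_mul hA ?_
    have e1 : A = M + B * K * A := by
      simp only [hM_def, P, Matrix.sub_mul, Matrix.one_mul]
      abel
    have e2 : A * u z = M * u z + B * (K * A * u z) := by
      conv_lhs => rw [e1]
      simp only [Matrix.add_mul, Matrix.mul_assoc]
    rw [Matrix.sub_mul, e2, hMu, hRz, Matrix.mul_sub, Matrix.smul_mul, Matrix.one_mul,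
      Matrix.mul_smul B _ (1 : Matrix (Fin m) (Fin m) ℂ), Matrix.mul_one, smul_sub]
    abel
  -- If Rv = 0 then uv = GRv = 0, and Mu = z(u − B) forces Bv = 0.
  have hRinj : ∀ z, Function.Injective (R z).vecMul := fun z => by
    rw [Matrix.vecMul_injective_iff_isUnit, ← Matrix.mulVec_injective_iff_isUnit]
    refine (injective_iff_map_eq_zero (R z).mulVecLin).2 fun v hv => ?_
    rw [Matrix.mulVecLin_apply] at hv
    have hz0 := Circle.coe_ne_zero z
    have huv : u z *ᵥ v = 0 := by
      rw [← hGR, ← Matrix.mulVec_mulVec, hv, Matrix.mulVec_zero]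
    have h1 := congrArg (· *ᵥ v) (hMu z)
    simp only [Matrix.smul_mulVec, Matrix.sub_mulVec, ← Matrix.mulVec_mulVec, huv,
      Matrix.mulVec_zero, zero_sub, smul_neg] at h1
    have h2 : B *ᵥ v = 0 := by
      have := (neg_eq_zero.1 h1.symm)
      exact (smul_eq_zero.1 this).resolve_left hz0
    exact hB (by rw [h2, Matrix.mulVec_zero])
  refine ⟨fun z => R z * N * (R z)ᴴ,
    (hR.matrix_mul continuous_const).matrix_mul hR.matrix_conjTranspose,
    fun z => hN.mul_mul_conjTranspose_same (hRinj z), ?_⟩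
  rw [← hX]
  congr 1
  funext z
  rw [← hGR, Matrix.conjTranspose_mul]
  simp only [Matrix.mul_assoc]

end PositiveDensity

/-! ### Strict convexity, barrier estimate and coercivity. -/

section DualFunctional

open scoped Matrix.Norms.L2Operator

variable {n m : ℕ} {A : Matrix (Fin n) (Fin n) ℂ} {B : Matrix (Fin n) (Fin m) ℂ}
  {Ψ : Circle → Matrix (Fin m) (Fin m) ℂ}

theorem isClosed_setOf_posSemidef (k : ℕ) :
    IsClosed {M : Matrix (Fin k) (Fin k) ℂ | M.PosSemidef} := by
  have : {M : Matrix (Fin k) (Fin k) ℂ | M.PosSemidef} =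
      {M | Mᴴ = M} ∩ ⋂ x : Fin k → ℂ, {M | 0 ≤ star x ⬝ᵥ M *ᵥ x} := by
    ext M
    simp only [Set.mem_ofPred_eq, Set.mem_inter_iff, Set.mem_iInter]
    exact Matrix.posSemidef_iff_dotProduct_mulVec
  rw [this]
  refine (isClosed_eq (by fun_prop) continuous_id).inter (isClosed_iInter fun x => ?_)
  exact isClosed_le continuous_const (by fun_prop)

theorem continuous_QFun (hA : IsStabilityMatrix A) (L : Matrix (Fin n) (Fin n) ℂ) :
    Continuous (QFun A B L) := by
  have hG := continuous_transferFun B hA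
  exact continuous_const.add
    ((hG.matrix_conjTranspose.matrix_mul continuous_const).matrix_mul hG)

theorem continuous_QFun_left (z : Circle) :
    Continuous fun L : Matrix (Fin n) (Fin n) ℂ => QFun A B L z := by
  unfold QFun
  fun_prop

theorem QFun_zero (z : Circle) : QFun A B 0 z = 1 := by
  rw [QFun, Matrix.mul_zero, Matrix.zero_mul, add_zero]

theorem isHermitian_conj_transferFun {L : Matrix (Fin n) (Fin n) ℂ} (hL : L.IsHermitian)
    (z : Circle) : ((transferFun A B z)ᴴ * L * transferFun A B z).IsHermitian := by
  rw [Matrix.IsHermitian, Matrix.conjTranspose_mul, Matrix.conjTranspose_mul,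
    Matrix.conjTranspose_conjTranspose, hL.eq, Matrix.mul_assoc]

theorem isHermitian_QFun {L : Matrix (Fin n) (Fin n) ℂ} (hL : L.IsHermitian) (z : Circle) :
    (QFun A B L z).IsHermitian :=
  Matrix.isHermitian_one.add (isHermitian_conj_transferFun hL z)

theorem QFun_combo {s t : ℝ} (hst : s + t = 1) (L M : Matrix (Fin n) (Fin n) ℂ) (z : Circle) :
    QFun A B (s • L + t • M) z = s • QFun A B L z + t • QFun A B M z := by
  have : (1 : Matrix (Fin m) (Fin m) ℂ) = s • 1 + t • 1 := by rw [← add_smul, hst, one_smul]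
  simp only [QFun, Matrix.mul_add, Matrix.add_mul, Matrix.mul_smul, Matrix.smul_mul, smul_add]
  nth_rewrite 1 [this]
  abel

theorem exists_norm_QFun_sub_le (hA : IsStabilityMatrix A) (B : Matrix (Fin n) (Fin m) ℂ) :
    ∃ c : ℝ, 0 ≤ c ∧ ∀ (L M : Matrix (Fin n) (Fin n) ℂ) (z : Circle),
      ‖QFun A B L z - QFun A B M z‖ ≤ c * ‖L - M‖ := by
  obtain ⟨g, hg0, hg⟩ := exists_norm_le_of_continuous (continuous_transferFun B hA)
  refine ⟨g * g, by positivity, fun L M z => ?_⟩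
  have : QFun A B L z - QFun A B M z = (transferFun A B z)ᴴ * (L - M) * transferFun A B z := by
    simp only [QFun, Matrix.mul_sub, Matrix.sub_mul]
    abel
  rw [this]
  refine (Matrix.l2_opNorm_mul _ _).trans ?_
  have h1 := Matrix.l2_opNorm_mul (transferFun A B z)ᴴ (L - M)
  rw [Matrix.l2_opNorm_conjTranspose] at h1
  calc _ ≤ (‖transferFun A B z‖ * ‖L - M‖) * ‖transferFun A B z‖ := by gcongr
    _ ≤ (g * ‖L - M‖) * g := by gcongr <;> exact hg z
    _ = _ := by ring

theorem exists_QFun_lipschitz (hA : IsStabilityMatrix A) (B : Matrix (Fin n) (Fin m) ℂ) :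
    ∃ c : ℝ, 0 ≤ c ∧ ∀ (L : Matrix (Fin n) (Fin n) ℂ) (s t : ℝ),
      ‖QFun A B L (Circle.exp s) - QFun A B L (Circle.exp t)‖ ≤ c * ‖L‖ * |s - t| := by
  obtain ⟨g, hg0, hg⟩ := exists_norm_le_of_continuous (continuous_transferFun B hA)
  obtain ⟨l, hl0, hl⟩ := exists_transferFun_lipschitz B hA
  refine ⟨2 * g * l, by positivity, fun L s t => ?_⟩
  set G := transferFun A B (Circle.exp s)
  set H := transferFun A B (Circle.exp t)
  have hGH : ‖G - H‖ ≤ l * |s - t| := (hl _ _).trans (by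
    gcongr; exact norm_exp_sub_exp_le s t)
  have hG : ‖G‖ ≤ g := hg _
  have hH : ‖H‖ ≤ g := hg _
  have : QFun A B L (Circle.exp s) - QFun A B L (Circle.exp t) =
      Gᴴ * L * (G - H) + (G - H)ᴴ * L * H := by
    simp only [QFun, Matrix.mul_sub, Matrix.sub_mul, Matrix.conjTranspose_sub, G, H]
    abel
  rw [this]
  have b : ∀ X Y : Matrix (Fin n) (Fin m) ℂ, ‖Xᴴ * L * Y‖ ≤ ‖X‖ * ‖L‖ * ‖Y‖ := fun X Y => by
    refine (Matrix.l2_opNorm_mul _ _).trans ?_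
    have h1 := Matrix.l2_opNorm_mul Xᴴ L
    rw [Matrix.l2_opNorm_conjTranspose] at h1
    gcongr
  calc _ ≤ ‖G‖ * ‖L‖ * ‖G - H‖ + ‖G - H‖ * ‖L‖ * ‖H‖ :=
        (norm_add_le _ _).trans (add_le_add (b _ _) (b _ _))
    _ ≤ g * ‖L‖ * (l * |s - t|) + (l * |s - t|) * ‖L‖ * g := by gcongr
    _ = _ := by ring

/-- Writing one factor of tr L² as Γ(Φ) turns it into ∫ tr G*LGΦ = 0. Restricting to Range Γ thus
removes exactly the directions invisible to J's barrier. -/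
theorem eq_zero_of_forall_conj_eq_zero (hA : IsStabilityMatrix A) {L : Matrix (Fin n) (Fin n) ℂ}
    (hL : L ∈ Set.range (gammaOp A B))
    (h : ∀ z, (transferFun A B z)ᴴ * L * transferFun A B z = 0) : L = 0 := by
  have hH := isHermitian_of_mem_range_gammaOp hL
  obtain ⟨Φ, hΦ⟩ := hL
  have h1 := trace_mul_circleMean_re (B := B) hA
    (continuous_subtype_val.comp Φ.continuous) L
  have h2 : (L * L).trace.re = 0 := by
    nth_rewrite 2 [← hΦ]
    refine h1.trans ?_
    simp [h, realMean]
  have h3 : (Lᴴ * L).PosSemidef := Matrix.posSemidef_conjTranspose_mul_self L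
  rw [← Matrix.conjTranspose_mul_self_eq_zero]
  refine eq_zero_of_trace_re_eq_zero h3 ?_
  rwa [hH.eq]

theorem IsSpectralDensity.meanIntegrable_mul (hΨ : IsSpectralDensity Ψ)
    {F : Circle → Matrix (Fin m) (Fin m) ℂ} (hF : Continuous F) :
    MeanIntegrable fun z => F z * Ψ z := by
  obtain ⟨a, ha, hae⟩ := hΨ.coercive
  obtain ⟨b, hbe⟩ := hΨ.bounded
  obtain ⟨c, hc0, hc⟩ := exists_entry_norm_le m m
  have hΨi : ∀ i j, IntervalIntegrable (fun θ : ℝ => Ψ (Circle.exp θ) i j) volume 0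
      (2 * Real.pi) := fun i j => by
    rw [intervalIntegrable_iff]
    refine Measure.integrableOn_of_bounded (M := c * ‖(b : ℂ) • (1 : Matrix (Fin m) (Fin m) ℂ)‖)
      measure_Ioc_lt_top.ne (hΨ.measurable i j).aestronglyMeasurable (ae_restrict_of_ae ?_)
    filter_upwards [hae, hbe] with θ h1 h2
    refine (hc _ i j).trans ?_
    gcongr
    refine norm_le_of_bounds ?_ h2
    simpa using h1.add (posSemidef_ofReal_smul_one (k := m) ha.le)
  intro i j
  simp only [Matrix.mul_apply]
  have h := IntervalIntegrable.sum (μ := volume) (a := 0) (b := 2 * Real.pi) Finset.univ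
    (f := fun (x : Fin m) (θ : ℝ) => F (Circle.exp θ) i x * Ψ (Circle.exp θ) x j)
    fun x _ => (hΨi x j).continuousOn_mul
      ((hF.comp Circle.exp.continuous).matrix_elem i x).continuousOn
  have he : (∑ x : Fin m, fun θ : ℝ => F (Circle.exp θ) i x * Ψ (Circle.exp θ) x j) =
      fun θ : ℝ => ∑ x, F (Circle.exp θ) i x * Ψ (Circle.exp θ) x j := by
    funext θ
    simp
  exact he ▸ h

variable (A B Ψ) in
/-- The nonlinear part `tr ∫ (I + G* Λ G)⁻¹ Ψ` of the dual functional. -/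
def barrier (L : Matrix (Fin n) (Fin n) ℂ) : ℝ :=
  realMean fun z => ((QFun A B L z)⁻¹ * Ψ z).trace.re

theorem meanIntegrable_inv_QFun_mul (hA : IsStabilityMatrix A) (hΨ : IsSpectralDensity Ψ)
    {L : Matrix (Fin n) (Fin n) ℂ} (hL : ∀ z, (QFun A B L z).PosDef) :
    MeanIntegrable fun z => (QFun A B L z)⁻¹ * Ψ z :=
  hΨ.meanIntegrable_mul (continuous_inv_of_posDef (continuous_QFun hA L) hL)

/-- Positivity of `QFun` makes its inverse continuous, which provides the integrability needed to
exchange trace and integral. -/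
theorem dualJ_eq (hA : IsStabilityMatrix A) (hΨ : IsSpectralDensity Ψ)
    {L : Matrix (Fin n) (Fin n) ℂ} (hL : ∀ z, (QFun A B L z).PosDef)
    (S : Matrix (Fin n) (Fin n) ℂ) :
    dualJ A B Ψ L S = barrier A B Ψ L + (L * S).trace.re := by
  rw [dualJ, Complex.add_re, circleMean_trace_re (meanIntegrable_inv_QFun_mul hA hΨ hL), barrier]

theorem barrier_nonneg (hΨ : IsSpectralDensity Ψ) {L : Matrix (Fin n) (Fin n) ℂ}
    (hL : ∀ z, (QFun A B L z).PosDef) : 0 ≤ barrier A B Ψ L := by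
  obtain ⟨a, ha, hae⟩ := hΨ.coercive
  refine mul_nonneg (by positivity) (intervalIntegral.integral_nonneg_of_ae
    (by positivity) ?_)
  filter_upwards [hae] with θ hθ
  have h1 := smul_trace_re_le_trace_mul_re (hL (Circle.exp θ)).inv.posSemidef hθ
  have h2 := (Complex.le_def.1 (hL (Circle.exp θ)).inv.posSemidef.trace_nonneg).1
  exact (mul_nonneg ha.le h2).trans h1

/-- Coercivity of Ψ replaces the remainder by a·s·tr E*Q_L E, free of Ψ and continuous in z. Strict
positivity at a single point therefore makes its mean positive. -/
theorem barrier_combo_lt (hA : IsStabilityMatrix A) (hΨ : IsSpectralDensity Ψ)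
    {L M : Matrix (Fin n) (Fin n) ℂ} (hL : ∀ z, (QFun A B L z).PosDef)
    (hM : ∀ z, (QFun A B M z).PosDef) (hne : ∃ z, QFun A B L z ≠ QFun A B M z) {s t : ℝ}
    (hs : 0 < s) (ht : 0 < t) (hst : s + t = 1) :
    barrier A B Ψ (s • L + t • M) < s * barrier A B Ψ L + t * barrier A B Ψ M := by
  obtain ⟨a, ha, hae⟩ := hΨ.coercive
  obtain ⟨z₀, hz₀⟩ := hne
  set Z := s • L + t • M
  have hZQ : ∀ z, QFun A B Z z = s • QFun A B L z + t • QFun A B M z := QFun_combo hst L M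
  have hZ : ∀ z, (QFun A B Z z).PosDef := fun z => by
    rw [hZQ]
    exact ((hL z).smul (a := (s : ℂ)) (by exact_mod_cast hs)).add
      ((hM z).smul (a := (t : ℂ)) (by exact_mod_cast ht))
  set E : Circle → Matrix (Fin m) (Fin m) ℂ := fun z => (QFun A B L z)⁻¹ - (QFun A B Z z)⁻¹
  have hE : Continuous E := (continuous_inv_of_posDef (continuous_QFun hA L) hL).sub
    (continuous_inv_of_posDef (continuous_QFun hA Z) hZ)
  set D : Circle → ℝ := fun z => ((E z)ᴴ * QFun A B L z * E z).trace.re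
  have hDm : Continuous fun z => (E z)ᴴ * QFun A B L z * E z :=
    (hE.matrix_conjTranspose.matrix_mul (continuous_QFun hA L)).matrix_mul hE
  have hD : Continuous D := Complex.continuous_re.comp hDm.matrix_trace
  have hpsd : ∀ z, ((E z)ᴴ * QFun A B L z * E z).PosSemidef := fun z =>
    (hL z).posSemidef.conjTranspose_mul_mul_same _
  have hD0 : ∀ z, 0 ≤ D z := fun z => (Complex.le_def.1 (hpsd z).trace_nonneg).1
  have hDpos : 0 < D z₀ := by
    refine lt_of_le_of_ne (hD0 z₀) fun h0 => hz₀ ?_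
    have hzero := eq_zero_of_trace_re_eq_zero (hpsd z₀) h0.symm
    have hE0 : E z₀ = 0 := by
      refine Matrix.ext_iff_mulVec.2 fun v => ?_
      rw [Matrix.zero_mulVec]
      by_contra hv
      have h1 := (hL z₀).dotProduct_mulVec_pos hv
      have h2 : star v ⬝ᵥ ((E z₀)ᴴ * QFun A B L z₀ * E z₀) *ᵥ v = 0 := by
        rw [hzero, Matrix.zero_mulVec, dotProduct_zero]
      rw [← Matrix.mulVec_mulVec, ← Matrix.mulVec_mulVec, Matrix.dotProduct_mulVec,
        ← Matrix.star_mulVec] at h2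
      exact h1.ne' h2
    have h3 : QFun A B L z₀ = QFun A B Z z₀ :=
      Matrix.inv_inj (sub_eq_zero.1 hE0) ((Matrix.isUnit_iff_isUnit_det _).1 (hL z₀).isUnit)
    rw [hZQ, ← sub_eq_zero] at h3
    have h4 : t • (QFun A B L z₀ - QFun A B M z₀) = 0 := by
      rw [← h3, eq_sub_of_add_eq hst]
      module
    exact sub_eq_zero.1 ((smul_eq_zero.1 h4).resolve_left ht.ne')
  have iL := (meanIntegrable_inv_QFun_mul hA hΨ hL).trace_re
  have iM := (meanIntegrable_inv_QFun_mul hA hΨ hM).trace_re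
  have iZ := (meanIntegrable_inv_QFun_mul hA hΨ hZ).trace_re
  have iD : IntervalIntegrable (fun θ : ℝ => D (Circle.exp θ)) volume 0 (2 * Real.pi) :=
    (hD.comp Circle.exp.continuous).intervalIntegrable _ _
  have key := realMean_mono_ae
    (f := fun z => ((QFun A B Z z)⁻¹ * Ψ z).trace.re + (a * s) * D z)
    (g := fun z => s * ((QFun A B L z)⁻¹ * Ψ z).trace.re + t * ((QFun A B M z)⁻¹ * Ψ z).trace.re)
    (iZ.add (iD.const_mul _)) ((iL.const_mul s).add (iM.const_mul t)) (by
      filter_upwards [hae] with θ hθ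
      have := trace_inv_mul_convex (hL (Circle.exp θ)) (hM (Circle.exp θ)) ha.le hs ht hst hθ
      rw [← hZQ] at this
      exact this)
  rw [realMean_add (f := fun z => ((QFun A B Z z)⁻¹ * Ψ z).trace.re) (g := fun z => (a * s) * D z)
      iZ (iD.const_mul _), realMean_const_mul,
    realMean_add (f := fun z => s * ((QFun A B L z)⁻¹ * Ψ z).trace.re)
      (g := fun z => t * ((QFun A B M z)⁻¹ * Ψ z).trace.re) (iL.const_mul s) (iM.const_mul t),
    realMean_const_mul, realMean_const_mul] at key
  have := mul_pos (mul_pos ha hs) (realMean_pos hD hD0 hDpos)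
  unfold barrier
  linarith

/-- Points of bounded norm at which the barrier is bounded are uniformly inside the domain. -/
theorem exists_lower_bound_of_barrier_le (hA : IsStabilityMatrix A) (B : Matrix (Fin n) (Fin m) ℂ)
    (hΨ : IsSpectralDensity Ψ) (R c : ℝ) : ∃ ε : ℝ, 0 < ε ∧ ∀ L : Matrix (Fin n) (Fin n) ℂ,
      L.IsHermitian → (∀ z, (QFun A B L z).PosDef) → ‖L‖ ≤ R → barrier A B Ψ L ≤ c →
      ∀ z, (QFun A B L z - (ε : ℂ) • (1 : Matrix (Fin m) (Fin m) ℂ)).PosSemidef := by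
  obtain ⟨a, ha, hae⟩ := hΨ.coercive
  obtain ⟨l, hl0, hl⟩ := exists_QFun_lipschitz hA B
  -- A Lipschitz constant along the circle, valid for all ‖L‖ ≤ R; the summand 1 keeps it positive.
  set K := l * max R 0 + 1
  have hK : 0 < K := by positivity
  -- Obtained by solving a(2πK)⁻¹ log((q + 2πK)/q) ≤ c; then q + 2πK ≤ q·exp T bounds q below.
  set T := 2 * Real.pi * K * c / a
  refine ⟨2 * Real.pi * K / Real.exp T, by positivity, fun L hLh hL hLR hLc z => ?_⟩
  refine posSemidef_sub_of_unit (isHermitian_QFun hLh z) fun v hv => ?_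
  obtain ⟨θ₀, -, rfl⟩ := exists_exp_eq z
  have hv0 : v ≠ 0 := by rintro rfl; simp at hv
  set q := (star v ⬝ᵥ QFun A B L (Circle.exp θ₀) *ᵥ v).re
  have hq : 0 < q := (Complex.lt_def.1 ((hL (Circle.exp θ₀)).dotProduct_mulVec_pos hv0)).1
  have hinv : Continuous fun z => (QFun A B L z)⁻¹ :=
    continuous_inv_of_posDef (continuous_QFun hA L) hL
  have hinvt : Continuous fun θ : ℝ => (QFun A B L (Circle.exp θ))⁻¹.trace.re :=
    Complex.continuous_re.comp (hinv.matrix_trace.comp Circle.exp.continuous)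
  -- The vector v is kept fixed while moving along the circle from `θ₀`: its quadratic form grows
  -- from q at rate at most K.
  have hpt : ∀ x ∈ Set.Icc 0 (2 * Real.pi),
      (q + K * x)⁻¹ ≤ (QFun A B L (Circle.exp (θ₀ + x)))⁻¹.trace.re := fun x hx => by
    have hKx : 0 ≤ K * x := mul_nonneg hK.le hx.1
    refine le_trace_inv_re (hL _) hv (by linarith) ?_
    have h1 := re_dotProduct_mulVec_le_norm ((isHermitian_QFun (A := A) (B := B) hLh
      (Circle.exp (θ₀ + x))).sub (isHermitian_QFun (A := A) (B := B) hLh (Circle.exp θ₀))) hv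
    have h2 := hl L (θ₀ + x) θ₀
    rw [Matrix.sub_mulVec, dotProduct_sub, Complex.sub_re] at h1
    rw [add_sub_cancel_left, abs_of_nonneg hx.1] at h2
    have h3 : l * ‖L‖ * x ≤ K * x := by
      refine mul_le_mul_of_nonneg_right ?_ hx.1
      have : l * ‖L‖ ≤ l * max R 0 := by gcongr; exact hLR.trans (le_max_left _ _)
      linarith
    linarith
  have hint : ∫ x in (0 : ℝ)..(2 * Real.pi), (q + K * x)⁻¹ =
      K⁻¹ * Real.log ((q + K * (2 * Real.pi)) / q) := by
    rw [intervalIntegral.integral_comp_add_mul (fun y => y⁻¹) hK.ne', mul_zero, add_zero,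
      integral_inv_of_pos hq (by positivity), smul_eq_mul]
  have h1 : K⁻¹ * Real.log ((q + K * (2 * Real.pi)) / q) ≤
      ∫ θ in (0 : ℝ)..(2 * Real.pi), (QFun A B L (Circle.exp θ))⁻¹.trace.re := by
    have hper : Function.Periodic
        (fun θ : ℝ => (QFun A B L (Circle.exp θ))⁻¹.trace.re) (2 * Real.pi) := fun θ => by
      simp only [Circle.periodic_exp θ]
    have e1 := hper.intervalIntegral_add_eq 0 θ₀
    rw [zero_add] at e1
    have e2 := intervalIntegral.integral_comp_add_left (a := 0) (b := 2 * Real.pi)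
      (fun θ : ℝ => (QFun A B L (Circle.exp θ))⁻¹.trace.re) θ₀
    rw [add_zero] at e2
    rw [← hint, e1, ← e2]
    refine intervalIntegral.integral_mono_on (by positivity)
      (ContinuousOn.intervalIntegrable ?_)
      ((hinvt.comp (continuous_const.add continuous_id)).intervalIntegrable _ _) hpt
    refine ContinuousOn.inv₀ (by fun_prop) fun x hx => ?_
    rw [Set.uIcc_of_le (by positivity)] at hx
    have := mul_nonneg hK.le hx.1
    exact (by linarith : 0 < q + K * x).ne'
  have h2 : a * realMean (fun z => (QFun A B L z)⁻¹.trace.re) ≤ barrier A B Ψ L := by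
    rw [← realMean_const_mul]
    refine realMean_mono_ae ((hinvt.intervalIntegrable _ _).const_mul a)
      (meanIntegrable_inv_QFun_mul hA hΨ hL).trace_re ?_
    filter_upwards [hae] with θ hθ
    exact smul_trace_re_le_trace_mul_re (hL (Circle.exp θ)).inv.posSemidef hθ
  have h3 : Real.log ((q + K * (2 * Real.pi)) / q) ≤ T := by
    rw [realMean, ← mul_assoc] at h2
    have h4 := (mul_le_mul_of_nonneg_left h1
      (by positivity : 0 ≤ a * (2 * Real.pi)⁻¹)).trans (h2.trans hLc)
    rw [le_div_iff₀ ha]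
    have h5 := mul_le_mul_of_nonneg_left h4 (by positivity : 0 ≤ 2 * Real.pi * K)
    calc _ = 2 * Real.pi * K * (a * (2 * Real.pi)⁻¹ *
          (K⁻¹ * Real.log ((q + K * (2 * Real.pi)) / q))) := by field_simp
      _ ≤ _ := h5
  have h4 := (Real.log_le_iff_le_exp (by positivity)).1 h3
  rw [div_le_iff₀ hq] at h4
  rw [div_le_iff₀ (Real.exp_pos T)]
  nlinarith

/-- Coercivity of `Λ ↦ tr Λ Σ` on the closure of the domain, for `Σ` in `P_Γ`. -/
theorem exists_norm_le_of_trace_le (hA : IsStabilityMatrix A)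
    (hB : Function.Injective B.mulVec) {S : Matrix (Fin n) (Fin n) ℂ} (hS : S ∈ PGamma A B)
    (c : ℝ) : ∃ R : ℝ, ∀ L ∈ LinearMap.range (gammaLinear B hA),
      (∀ z, (QFun A B L z).PosSemidef) → (L * S).trace.re ≤ c → ‖L‖ ≤ R := by
  obtain ⟨Φ, hΦc, hΦpos, hΦS⟩ := exists_posDef_density hA hB hS
  obtain ⟨ε, hε, hΦε⟩ := exists_uniform_lower_bound hΦc hΦpos
  have hG := continuous_transferFun B hA
  set V := LinearMap.range (gammaLinear B hA)
  have hVmem : ∀ {L}, L ∈ V → L ∈ Set.range (gammaOp A B) := fun h => h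
  have hVclosed : IsClosed (V : Set (Matrix (Fin n) (Fin n) ℂ)) := V.closed_of_finiteDimensional
  -- Homogenization: a matrix L of norm above 1 becomes (‖L‖⁻¹, L/‖L‖). Points with first coordinate
  -- 0 would be recession directions.
  set D : Set (ℝ × Matrix (Fin n) (Fin n) ℂ) := {p | p.1 ∈ Set.Icc (0 : ℝ) 1 ∧
    p.2 ∈ Metric.sphere (0 : Matrix (Fin n) (Fin n) ℂ) 1 ∧ p.2 ∈ V ∧
    (∀ z, (p.1 • (1 : Matrix (Fin m) (Fin m) ℂ) +
      (transferFun A B z)ᴴ * p.2 * transferFun A B z).PosSemidef) ∧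
    (p.2 * S).trace.re ≤ p.1 * c}
  have hDc : IsCompact D := by
    have : ProperSpace (Matrix (Fin n) (Fin n) ℂ) := FiniteDimensional.proper ℝ _
    have hK := (isCompact_Icc (a := (0 : ℝ)) (b := 1)).prod
      (isCompact_sphere (0 : Matrix (Fin n) (Fin n) ℂ) 1)
    refine hK.of_isClosed_subset ?_ fun p hp => ⟨hp.1, hp.2.1⟩
    refine (isClosed_Icc.preimage continuous_fst).inter
      ((Metric.isClosed_sphere.preimage continuous_snd).inter
      ((hVclosed.preimage continuous_snd).inter (IsClosed.inter ?_ ?_)))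
    · have : {p : ℝ × Matrix (Fin n) (Fin n) ℂ | ∀ z, (p.1 • (1 : Matrix (Fin m) (Fin m) ℂ) +
          (transferFun A B z)ᴴ * p.2 * transferFun A B z).PosSemidef} =
          ⋂ z, {p | (p.1 • (1 : Matrix (Fin m) (Fin m) ℂ) +
            (transferFun A B z)ᴴ * p.2 * transferFun A B z).PosSemidef} := by
        ext p
        simp
      rw [show (fun p : ℝ × Matrix (Fin n) (Fin n) ℂ => ∀ z, (p.1 • (1 : Matrix (Fin m) (Fin m) ℂ) +
          (transferFun A B z)ᴴ * p.2 * transferFun A B z).PosSemidef) = _ from this]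
      refine isClosed_iInter fun z => (isClosed_setOf_posSemidef m).preimage ?_
      fun_prop
    · exact isClosed_le (f := fun p : ℝ × Matrix (Fin n) (Fin n) ℂ => (p.2 * S).trace.re)
        (g := fun p => p.1 * c) (by fun_prop) (by fun_prop)
  -- At s = 0 the integrand tr G*MGΦ is nonnegative with mean at most 0. As Φ ≥ ε this forces G*MG =
  -- 0, so M = 0, against ‖M‖ = 1.
  have hpos : ∀ p ∈ D, 0 < p.1 := by
    rintro ⟨s, M⟩ ⟨hs, hM1, hMV, hMpsd, hMS⟩
    refine lt_of_le_of_ne hs.1 fun h0 => ?_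
    simp only at h0 hM1 hMV hMpsd hMS
    subst h0
    simp only [zero_smul, zero_add, zero_mul] at hMpsd hMS
    rw [← hΦS, trace_mul_circleMean_re hA hΦc] at hMS
    have hc : Continuous fun z => (transferFun A B z)ᴴ * M * transferFun A B z :=
      (hG.matrix_conjTranspose.matrix_mul continuous_const).matrix_mul hG
    have hge : ∀ z, ε * ((transferFun A B z)ᴴ * M * transferFun A B z).trace.re ≤
        ((transferFun A B z)ᴴ * M * transferFun A B z * Φ z).trace.re := fun z =>
      smul_trace_re_le_trace_mul_re (hMpsd z) (hΦε z)
    have htr : ∀ z, 0 ≤ ((transferFun A B z)ᴴ * M * transferFun A B z).trace.re := fun z =>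
      (Complex.le_def.1 (hMpsd z).trace_nonneg).1
    have hzero : ∀ z, (transferFun A B z)ᴴ * M * transferFun A B z = 0 := by
      intro z
      refine eq_zero_of_trace_re_eq_zero (hMpsd z) ?_
      by_contra hne
      have hlt := lt_of_le_of_ne (htr z) (Ne.symm hne)
      have := realMean_pos (f := fun z =>
          ((transferFun A B z)ᴴ * M * transferFun A B z * Φ z).trace.re)
        (Complex.continuous_re.comp (hc.matrix_mul hΦc).matrix_trace)
        (fun z => (mul_nonneg hε.le (htr z)).trans (hge z))
        ((mul_pos hε hlt).trans_le (hge z))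
      exact absurd hMS (not_le.2 this)
    have hM0 := eq_zero_of_forall_conj_eq_zero hA (hVmem hMV) hzero
    rw [hM0] at hM1
    simp at hM1
  have hscale : ∀ L ∈ V, (∀ z, (QFun A B L z).PosSemidef) → (L * S).trace.re ≤ c → 1 < ‖L‖ →
      (‖L‖⁻¹, ‖L‖⁻¹ • L) ∈ D := by
    intro L hLV hLQ hLc hL1
    have hL0 : 0 < ‖L‖ := zero_lt_one.trans hL1
    refine ⟨⟨by positivity, inv_le_one_of_one_le₀ hL1.le⟩, ?_, V.smul_mem _ hLV, fun z => ?_, ?_⟩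
    · rw [mem_sphere_zero_iff_norm, norm_smul, norm_inv, norm_norm, inv_mul_cancel₀ hL0.ne']
    · have := (hLQ z).smul (a := ((‖L‖⁻¹ : ℝ) : ℂ)) (by rw [Complex.zero_le_real]; positivity)
      convert this using 1
      simp only [QFun, Matrix.mul_smul, Matrix.smul_mul, smul_add]
      rfl
    · simp only [Matrix.smul_mul, Matrix.trace_smul, Complex.smul_re, smul_eq_mul]
      gcongr
  rcases D.eq_empty_or_nonempty with hDe | hDne
  · refine ⟨1, fun L hLV hLQ hLc => ?_⟩
    by_contra! h
    have := hscale L hLV hLQ hLc h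
    rw [hDe] at this
    exact this
  -- The least first coordinate over the compact set is positive, and its inverse bounds ‖L‖.
  · obtain ⟨p, hpD, hp⟩ := hDc.exists_isMinOn hDne continuous_fst.continuousOn
    refine ⟨max 1 p.1⁻¹, fun L hLV hLQ hLc => ?_⟩
    rcases le_or_gt ‖L‖ 1 with h | h
    · exact h.trans (le_max_left _ _)
    · have := hp (hscale L hLV hLQ hLc h)
      simp only [Set.mem_ofPred_eq] at this
      exact ((le_inv_comm₀ (hpos p hpD) (zero_lt_one.trans h)).1 this).trans (le_max_right _ _)

end DualFunctional

/-! ### Existence, uniqueness and continuity of the minimizer on Range Γ. -/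

section Minimization

open scoped Matrix.Norms.L2Operator

variable {n m : ℕ} {A : Matrix (Fin n) (Fin n) ℂ} {B : Matrix (Fin n) (Fin m) ℂ}
  {Ψ : Circle → Matrix (Fin m) (Fin m) ℂ}

/-- `𝓛^H_Γ` as a subset of the real vector space `Range Γ`. -/
def dualDomain (hA : IsStabilityMatrix A) (B : Matrix (Fin n) (Fin m) ℂ) :
    Set (LinearMap.range (gammaLinear B hA)) :=
  {L | ∀ z, (QFun A B L z).PosDef}

theorem isHermitian_coe_range {hA : IsStabilityMatrix A}
    (L : LinearMap.range (gammaLinear B hA)) :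
    (L : Matrix (Fin n) (Fin n) ℂ).IsHermitian :=
  isHermitian_of_mem_range_gammaOp L.2

theorem mem_LHGamma_iff (hA : IsStabilityMatrix A) {L : Matrix (Fin n) (Fin n) ℂ} :
    L ∈ LHGamma A B ↔ ∃ h : L ∈ LinearMap.range (gammaLinear B hA),
      (⟨L, h⟩ : LinearMap.range (gammaLinear B hA)) ∈ dualDomain hA B :=
  ⟨fun h => ⟨h.2, h.1.2⟩, fun ⟨h1, h2⟩ => ⟨⟨isHermitian_of_mem_range_gammaOp h1, h2⟩, h1⟩⟩

/-- Q_L ≥ ε uniformly by compactness of the circle, and a perturbation of Q of norm at most ε/2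
leaves ε/2. In the radius, c + 1 guards against c = 0. -/
theorem isOpen_dualDomain (hA : IsStabilityMatrix A) (B : Matrix (Fin n) (Fin m) ℂ) :
    IsOpen (dualDomain hA B) := by
  obtain ⟨c, hc0, hc⟩ := exists_norm_QFun_sub_le hA B
  rw [Metric.isOpen_iff]
  intro L hL
  obtain ⟨ε, hε, hLε⟩ := exists_uniform_lower_bound (continuous_QFun hA L) hL
  refine ⟨ε / (2 * (c + 1)), by positivity, fun M hM z => ?_⟩
  have hML : ‖(M : Matrix (Fin n) (Fin n) ℂ) - L‖ < ε / (2 * (c + 1)) := by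
    rw [Metric.mem_ball, dist_eq_norm] at hM
    exact hM
  set E := QFun A B M z - QFun A B L z
  have hE : E.IsHermitian := (isHermitian_QFun (isHermitian_coe_range M) z).sub
    (isHermitian_QFun (isHermitian_coe_range L) z)
  have hEn : ‖E‖ ≤ ε / 2 := by
    refine (hc _ _ z).trans ?_
    calc c * ‖(M : Matrix (Fin n) (Fin n) ℂ) - L‖ ≤ (c + 1) * (ε / (2 * (c + 1))) := by
          gcongr
          linarith
      _ = ε / 2 := by field_simp
  have h1 := posSemidef_norm_smul_one_sub hE.neg
  rw [norm_neg] at h1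
  have h2 := ((hLε z).add h1).add (posSemidef_ofReal_smul_one (k := m) (sub_nonneg.2 hEn))
  refine posDef_of_posSemidef_sub (ε := ε / 2) (by positivity) ?_
  convert h2 using 1
  simp only [E]
  push_cast
  module

theorem convex_dualDomain (hA : IsStabilityMatrix A) (B : Matrix (Fin n) (Fin m) ℂ) :
    Convex ℝ (dualDomain hA B) := by
  rw [convex_iff_forall_pos]
  intro L hL M hM s t hs ht hst z
  have := QFun_combo (A := A) (B := B) hst (L : Matrix (Fin n) (Fin n) ℂ) M z
  rw [Submodule.coe_add, Submodule.coe_smul, Submodule.coe_smul, this]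
  exact ((hL z).smul (a := (s : ℂ)) (by exact_mod_cast hs)).add
    ((hM z).smul (a := (t : ℂ)) (by exact_mod_cast ht))

theorem zero_mem_dualDomain (hA : IsStabilityMatrix A) (B : Matrix (Fin n) (Fin m) ℂ) :
    0 ∈ dualDomain hA B := fun z => by
  rw [Submodule.coe_zero, QFun_zero]
  exact Matrix.PosDef.one

theorem strictConvexOn_barrier (hA : IsStabilityMatrix A) (B : Matrix (Fin n) (Fin m) ℂ)
    (hΨ : IsSpectralDensity Ψ) : StrictConvexOn ℝ (dualDomain hA B)
      fun L => barrier A B Ψ (L : Matrix (Fin n) (Fin n) ℂ) := by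
  refine ⟨convex_dualDomain hA B, fun L hL M hM hne s t hs ht hst => ?_⟩
  refine barrier_combo_lt hA hΨ hL hM ?_ hs ht hst
  by_contra! h
  refine hne (sub_eq_zero.1 (Subtype.ext ?_))
  refine eq_zero_of_forall_conj_eq_zero hA (L - M).2 fun z => ?_
  have := sub_eq_zero.2 (h z)
  rw [← this, Submodule.coe_sub]
  simp only [QFun, Matrix.mul_sub, Matrix.sub_mul]
  abel

variable (A B Ψ) in
/-- The dual functional on `Range Γ`. -/
def dualOnRange (hA : IsStabilityMatrix A) (S : Matrix (Fin n) (Fin n) ℂ)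
    (L : LinearMap.range (gammaLinear B hA)) : ℝ :=
  barrier A B Ψ (L : Matrix (Fin n) (Fin n) ℂ) + ((L : Matrix (Fin n) (Fin n) ℂ) * S).trace.re

theorem strictConvexOn_dualOnRange (hA : IsStabilityMatrix A) (B : Matrix (Fin n) (Fin m) ℂ)
    (hΨ : IsSpectralDensity Ψ) (S : Matrix (Fin n) (Fin n) ℂ) :
    StrictConvexOn ℝ (dualDomain hA B) (dualOnRange A B Ψ hA S) := by
  refine (strictConvexOn_barrier hA B hΨ).add_convexOn
    ⟨convex_dualDomain hA B, fun L _ M _ s t _ _ _ => le_of_eq ?_⟩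
  simp only [Submodule.coe_add, Submodule.coe_smul, Matrix.add_mul, Matrix.smul_mul,
    Matrix.trace_add, Matrix.trace_smul, Complex.add_re, Complex.smul_re]

/-- A convex function on an open set in finite dimension is continuous, so no passage to the limit
under the integral is needed for the barrier. -/
theorem continuousOn_dualOnRange (hA : IsStabilityMatrix A) (B : Matrix (Fin n) (Fin m) ℂ)
    (hΨ : IsSpectralDensity Ψ) :
    ContinuousOn (fun q : Matrix (Fin n) (Fin n) ℂ × LinearMap.range (gammaLinear B hA) =>
      dualOnRange A B Ψ hA q.1 q.2) (Set.univ ×ˢ dualDomain hA B) := by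
  have h := (strictConvexOn_barrier hA B hΨ).convexOn.continuousOn (isOpen_dualDomain hA B)
  refine ContinuousOn.add (h.comp continuous_snd.continuousOn fun q hq => hq.2) ?_
  fun_prop

theorem exists_isMinOn_dualOnRange (hA : IsStabilityMatrix A) (hB : Function.Injective B.mulVec)
    (hΨ : IsSpectralDensity Ψ) {S : Matrix (Fin n) (Fin n) ℂ} (hS : S ∈ PGamma A B) :
    ∃ L ∈ dualDomain hA B, IsMinOn (dualOnRange A B Ψ hA S) (dualDomain hA B) L := by
  have hproper : ProperSpace (LinearMap.range (gammaLinear B hA)) := FiniteDimensional.proper ℝ _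
  -- The sublevel set is that of Λ = 0. There tr ΛΣ ≤ c because the barrier is nonnegative, hence
  -- ‖Λ‖ ≤ R; with d a lower bound of tr ΛΣ on that ball, the barrier is at most c − d.
  set c := dualOnRange A B Ψ hA S 0
  obtain ⟨R, hR⟩ := exists_norm_le_of_trace_le hA hB hS c
  have htr : Continuous fun L : LinearMap.range (gammaLinear B hA) =>
      ((L : Matrix (Fin n) (Fin n) ℂ) * S).trace.re := by fun_prop
  obtain ⟨d, hd⟩ := ((isCompact_closedBall (0 : LinearMap.range (gammaLinear B hA)) R).image
    htr).bddBelow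
  obtain ⟨ε, hε, hεL⟩ := exists_lower_bound_of_barrier_le hA B hΨ R (c - d)
  set K : Set (LinearMap.range (gammaLinear B hA)) := Metric.closedBall 0 R ∩
    ⋂ z, {L | (QFun A B L z - (ε : ℂ) • (1 : Matrix (Fin m) (Fin m) ℂ)).PosSemidef}
  have hK : IsCompact K := by
    refine (isCompact_closedBall _ _).inter_right (isClosed_iInter fun z => ?_)
    exact (isClosed_setOf_posSemidef m).preimage
      (((continuous_QFun_left z).comp continuous_subtype_val).sub continuous_const)
  have hcont : ContinuousOn (dualOnRange A B Ψ hA S) (dualDomain hA B) :=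
    (continuousOn_dualOnRange hA B hΨ).comp
      (f := fun L : LinearMap.range (gammaLinear B hA) => (S, L)) (by fun_prop)
      fun L hL => ⟨trivial, hL⟩
  refine exists_isMinOn_of_sublevel_subset hcont hK (fun L hL z => ?_)
    (zero_mem_dualDomain hA B) fun L hL hLc => ?_
  · exact posDef_of_posSemidef_sub hε (Set.mem_iInter.1 hL.2 z)
  · have hLc' : barrier A B Ψ (L : Matrix (Fin n) (Fin n) ℂ) +
        ((L : Matrix (Fin n) (Fin n) ℂ) * S).trace.re ≤ c := hLc
    have hLR : ‖(L : Matrix (Fin n) (Fin n) ℂ)‖ ≤ R := by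
      refine hR L L.2 (fun z => (hL z).posSemidef) ?_
      linarith [barrier_nonneg hΨ hL]
    have hball : L ∈ Metric.closedBall (0 : LinearMap.range (gammaLinear B hA)) R := by
      rw [mem_closedBall_zero_iff]
      exact hLR
    have hdL := hd ⟨L, hball, rfl⟩
    exact ⟨hball, Set.mem_iInter.2 (hεL L (isHermitian_coe_range L) hL hLR (by linarith))⟩

theorem isMinOn_dualJ_iff (hA : IsStabilityMatrix A) (hΨ : IsSpectralDensity Ψ)
    (S : Matrix (Fin n) (Fin n) ℂ) {L : LinearMap.range (gammaLinear B hA)}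
    (hL : L ∈ dualDomain hA B) :
    IsMinOn (fun M => dualJ A B Ψ M S) (LHGamma A B) (L : Matrix (Fin n) (Fin n) ℂ) ↔
      IsMinOn (dualOnRange A B Ψ hA S) (dualDomain hA B) L := by
  simp only [isMinOn_iff]
  constructor
  · intro h M hM
    have := h M ((mem_LHGamma_iff hA).2 ⟨M.2, hM⟩)
    rwa [dualJ_eq hA hΨ hL, dualJ_eq hA hΨ hM] at this
  · intro h M hM
    obtain ⟨hM1, hM2⟩ := (mem_LHGamma_iff hA).1 hM
    have := h ⟨M, hM1⟩ hM2
    rwa [dualJ_eq hA hΨ hL, dualJ_eq hA hΨ hM2]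

theorem existsUnique_isMinOn_dualJ (hA : IsStabilityMatrix A)
    (hB : Function.Injective B.mulVec) (hΨ : IsSpectralDensity Ψ)
    {S : Matrix (Fin n) (Fin n) ℂ} (hS : S ∈ PGamma A B) :
    ∃! L, L ∈ LHGamma A B ∧ IsMinOn (fun M => dualJ A B Ψ M S) (LHGamma A B) L := by
  obtain ⟨L, hL, hmin⟩ := exists_isMinOn_dualOnRange hA hB hΨ hS
  refine ⟨L, ⟨(mem_LHGamma_iff hA).2 ⟨L.2, hL⟩, (isMinOn_dualJ_iff hA hΨ S hL).2 hmin⟩, ?_⟩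
  rintro M ⟨hM, hMmin⟩
  obtain ⟨hM1, hM2⟩ := (mem_LHGamma_iff hA).1 hM
  have h := (isMinOn_dualJ_iff (L := ⟨M, hM1⟩) hA hΨ S hM2).1 hMmin
  exact congrArg Subtype.val
    ((strictConvexOn_dualOnRange hA B hΨ S).eq_of_isMinOn h hmin hM2 hL)

theorem continuous_of_isMinOn_dualJ (hA : IsStabilityMatrix A) (hΨ : IsSpectralDensity Ψ)
    {X : Type*} [TopologicalSpace X] {σ : X → Matrix (Fin n) (Fin n) ℂ} (hσ : Continuous σ)
    (opt : X → LHGamma A B) (hopt : ∀ x, IsMinOn (fun M => dualJ A B Ψ M (σ x)) (LHGamma A B)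
      (opt x : Matrix (Fin n) (Fin n) ℂ)) : Continuous opt := by
  have hmem := fun x => (mem_LHGamma_iff hA).1 (opt x).2
  have h := continuous_argmin (isOpen_dualDomain hA B)
    (h := fun x => dualOnRange A B Ψ hA (σ x)) (opt := fun x => ⟨opt x, (hmem x).1⟩)
    (fun x => strictConvexOn_dualOnRange hA B hΨ (σ x))
    ((continuousOn_dualOnRange hA B hΨ).comp
      (f := fun q : X × LinearMap.range (gammaLinear B hA) => (σ q.1, q.2)) (by fun_prop)
      fun q hq => ⟨trivial, hq.2⟩)
    (fun x => (hmem x).2)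
    (fun x => (isMinOn_dualJ_iff (L := ⟨opt x, (hmem x).1⟩) hA hΨ (σ x) (hmem x).2).1 (hopt x))
  exact (continuous_subtype_val.comp h).subtype_mk _

theorem mulVec_injective_of_rank_eq (hB : B.rank = m) : Function.Injective B.mulVec := by
  have h := B.mulVecLin.finrank_range_add_finrank_ker
  rw [Module.finrank_fin_fun] at h
  have h0 : Module.finrank ℂ (LinearMap.ker B.mulVecLin) = 0 := by
    have : Module.finrank ℂ (LinearMap.range B.mulVecLin) = m := hB
    omega
  exact LinearMap.ker_eq_bot.1 (Submodule.finrank_eq_zero.1 h0)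

end Minimization

end SpectrumApprox

end

/-- Continuity is claimed for every selection of minimizers; by the uniqueness in the first clause
there is only one. -/
theorem mainTheorem5 {n m : ℕ}
    (A : Matrix (Fin n) (Fin n) ℂ) (B : Matrix (Fin n) (Fin m) ℂ)
    (hA : SpectrumApprox.IsStabilityMatrix A)
    (hB : B.rank = m)
    (hAB : SpectrumApprox.IsReachable A B)
    (Ψ : Circle → Matrix (Fin m) (Fin m) ℂ)
    (hΨ : SpectrumApprox.IsSpectralDensity Ψ) :
    (∀ S ∈ SpectrumApprox.PGamma A B,
      ∃! L, L ∈ SpectrumApprox.LHGamma A B ∧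
        IsMinOn (fun L' => SpectrumApprox.dualJ A B Ψ L' S) (SpectrumApprox.LHGamma A B) L) ∧
    (∀ Lopt : SpectrumApprox.PGamma A B → SpectrumApprox.LHGamma A B,
      (∀ S : SpectrumApprox.PGamma A B,
        IsMinOn (fun L' => SpectrumApprox.dualJ A B Ψ L' (S : Matrix (Fin n) (Fin n) ℂ))
          (SpectrumApprox.LHGamma A B) (Lopt S : Matrix (Fin n) (Fin n) ℂ)) →
      Continuous Lopt) :=
  ⟨fun _ hS => SpectrumApprox.existsUnique_isMinOn_dualJ hA
      (SpectrumApprox.mulVec_injective_of_rank_eq hB) hΨ hS,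
    fun Lopt h => SpectrumApprox.continuous_of_isMinOn_dualJ hA hΨ continuous_subtype_val Lopt h⟩
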